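/- Let $m\in\mathbb N$ and consider the scalar equation $$\dot x(t)+\sum_{k=1}^m a_k(t)\,x(h_k(t))=0,\qquad t\ge t_0, \tag{1}$$ with $t_0\ge 0$ and initial conditions $x(t)=\varphi(t)$ for $t<t_0$, $x(t_0)=x_0$, where $a_k:[0,\infty)\to\mathbb R$ are Lebesgue measurable and essentially bounded, $h_k:[0,\infty)\to\mathbb R$ are Lebesgue measurable with $h_k(t)\le t$ and $\limsup_{t\to\infty}h_k(t)=\infty$, and $\varphi:(-\infty,t_0)\to\mathbb R$ is Borel measurable and bounded. A solution is a function $x:\mathbb R\to\mathbb R$ that is locally absolutely continuous on $[t_0,\infty)$, satisfies (1) for almost all $t\ge t_0$ and satisfies the initial conditions. The fundamental function $X(t,s)$, $s\ge 0$, is the solution of (1) with $t_0=s$, $\varphi=0$, $x_0=1$. Equation (1) is - *stable* if for all $t_0\ge0$, $\varepsilon>0$ there is $\delta>0$ such that $\sup_{t<t_0}|\varphi(t)|+|x_0|<\delta$ implies $|x(t)|<\varepsilon$ for all $t\ge t_0$; - *asymptotically stable* if it is stable and for every $t_0\ge 0$ all solutions tend to $0$ as $t\to\infty$; - *exponentially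 stable* if there are $M,\mu>0$, independent of $t_0$, with $|x(t)|\le Me^{-\mu(t-t_0)}\bigl(|x_0|+\sup_{t<t_0}|\varphi(t)|\bigr)$ for all $t\ge t_0\ge 0$ and all solutions. **Theorem.** Suppose that $a_k(t)\ge 0$ a.e. for $k=1,\dots,m$, that $\sum_{k=1}^m a_k(t)\ne 0$ a.e. on $[0,\infty)$, that $$\int_0^\infty\sum_{k=1}^m a_k(t)\,dt=\infty,\qquad \limsup_{t\to\infty}\int_{h_k(t)}^t\sum_{i=1}^m a_i(s)\,ds<\infty\quad(k=1,\dots,m),$$ and that $$\limsup_{t\to\infty}\sum_{k=1}^m\frac{a_k(t)}{\sum_{i=1}^m a_i(t)}\int_{h_k(t)}^t\sum_{i=1}^m a_i(s)\,ds<1+\frac1e .$$ (Here $a_i$ is read as $0$ on $(-\infty,0)$, and these two upper limits, as well as the one of $t-h_k(t)$ below, are taken up to null sets, i.e. as essential upper limits.) Then equation (1) is asymptotically stable. If in addition there is $R>0$ such that $\liminf_{t\to\infty}\int_t^{t+R}\sum_{k=1}^m a_k(\tau)\,d\tau>0$, then the fundamental function of (1) exists and has an exponential estimate: there are $K,\lambda>0$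 with $|X(t,s)|\le Ke^{-\lambda(t-s)}$ for all $t\ge s\ge 0$. If, moreover, $\limsup_{t\to\infty}(t-h_k(t))<\infty$ for $k=1,\dots,m$, then (1) is exponentially stable. -/

import Mathlib

open Set Filter Topology MeasureTheory

/-!
The scalar linear delay equation `x'(t) + ∑ k, a k t * x (h k t) = 0`, `t ≥ t₀`, with coefficients
`a k` and delayed arguments `h k` that matter on `[0, ∞)` only.
-/

/-- Standing assumptions on the parameters of the equation: the coefficients are Lebesgue measurable
and essentially bounded on `[0, ∞)`; the delayed arguments are Lebesgue measurable on `[0, ∞)`,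
satisfy `h k t ≤ t`, and have upper limit `∞` at infinity.
(For real functions, `AEMeasurable` means Lebesgue measurable.) -/
structure DelayParams {m : ℕ} (a h : Fin m → ℝ → ℝ) : Prop where
  coeff_bounded : ∀ k, MemLp (a k) ⊤ (volume.restrict (Ici (0 : ℝ)))
  delay_measurable : ∀ k, AEMeasurable (h k) (volume.restrict (Ici (0 : ℝ)))
  delay_le : ∀ k, ∀ t, 0 ≤ t → h k t ≤ t
  delay_limsup : ∀ k, limsup (fun t : ℝ => (h k t : EReal)) atTop = ⊤

/-- `φ` on `(-∞, t₀)` is an admissible initial function: Borel measurable and bounded. -/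
def IsInitialFunction (t₀ : ℝ) (φ : ℝ → ℝ) : Prop :=
  Measurable (fun t : Iio t₀ => φ t) ∧ ∃ B : ℝ, ∀ t, t < t₀ → |φ t| ≤ B

/-- `sup_{t < t₀} |φ t|`. -/
noncomputable def initialSup (t₀ : ℝ) (φ : ℝ → ℝ) : ℝ :=
  sSup ((fun t => |φ t|) '' Iio t₀)

/-- `x` is a solution of `x'(t) + ∑ k, a k t * x (h k t) = 0` for `t ≥ t₀` with the initial
conditions `x t = φ t` for `t < t₀` and `x t₀ = x₀`: it is absolutely continuous on every `[t₀, T]`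
and satisfies the equation for almost all `t ≥ t₀`. -/
structure IsSolution {m : ℕ} (a h : Fin m → ℝ → ℝ) (t₀ : ℝ) (φ : ℝ → ℝ) (x₀ : ℝ)
    (x : ℝ → ℝ) : Prop where
  absCont : ∀ T, t₀ ≤ T → AbsolutelyContinuousOnInterval x t₀ T
  equation : ∀ᵐ t ∂(volume.restrict (Ici t₀)), HasDerivAt x (-∑ k, a k t * x (h k t)) t
  eq_before : ∀ t, t < t₀ → x t = φ t
  eq_start : x t₀ = x₀

/-- `X` is the fundamental function: for each `s ≥ 0`, `X · s` is the solution with initial point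
`s`, zero initial function and initial value `1`. -/
def IsFundamentalFunction {m : ℕ} (a h : Fin m → ℝ → ℝ) (X : ℝ → ℝ → ℝ) : Prop :=
  ∀ s, 0 ≤ s → IsSolution a h s (fun _ => 0) 1 (fun t => X t s)

/-- The equation is stable. -/
def IsStableEq {m : ℕ} (a h : Fin m → ℝ → ℝ) : Prop :=
  ∀ t₀ : ℝ, 0 ≤ t₀ → ∀ ε : ℝ, 0 < ε → ∃ δ : ℝ, 0 < δ ∧
    ∀ (φ : ℝ → ℝ) (x₀ : ℝ) (x : ℝ → ℝ), IsInitialFunction t₀ φ → IsSolution a h t₀ φ x₀ x →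
      initialSup t₀ φ + |x₀| < δ → ∀ t, t₀ ≤ t → |x t| < ε

/-- The equation is asymptotically stable: stable, and all solutions tend to zero. -/
def IsAsymptoticallyStableEq {m : ℕ} (a h : Fin m → ℝ → ℝ) : Prop :=
  IsStableEq a h ∧
    ∀ t₀ : ℝ, 0 ≤ t₀ → ∀ (φ : ℝ → ℝ) (x₀ : ℝ) (x : ℝ → ℝ), IsInitialFunction t₀ φ →
      IsSolution a h t₀ φ x₀ x → Tendsto x atTop (𝓝 0)

/-- The equation is (uniformly) exponentially stable. -/
def IsExponentiallyStableEq {m : ℕ} (a h : Fin m → ℝ → ℝ) : Prop :=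
  ∃ M μ : ℝ, 0 < M ∧ 0 < μ ∧
    ∀ t₀ : ℝ, 0 ≤ t₀ → ∀ (φ : ℝ → ℝ) (x₀ : ℝ) (x : ℝ → ℝ), IsInitialFunction t₀ φ →
      IsSolution a h t₀ φ x₀ x →
        ∀ t, t₀ ≤ t → |x t| ≤ M * Real.exp (-μ * (t - t₀)) * (|x₀| + initialSup t₀ φ)

/-- The fundamental function (exists and) has an exponential estimation. -/
def FundamentalFunctionHasExpEstimate {m : ℕ} (a h : Fin m → ℝ → ℝ) : Prop :=
  (∃ X, IsFundamentalFunction a h X) ∧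
    ∃ K lam : ℝ, 0 < K ∧ 0 < lam ∧ ∀ X, IsFundamentalFunction a h X →
      ∀ t s, 0 ≤ s → s ≤ t → |X t s| ≤ K * Real.exp (-lam * (t - s))

/-- The filter of `t → ∞` up to Lebesgue null sets; a `limsup` along it is the essential upper limit
at infinity. -/
noncomputable def essAtTop : Filter ℝ := atTop ⊓ ae volume

/-- `∫_{h k t}^t ∑ i, a i s ds`, where the coefficients live on `[0, ∞)`, so that the lower limit is
read as `max (h k t) 0`. -/
noncomputable def delayIntegral {m : ℕ} (a h : Fin m → ℝ → ℝ) (k : Fin m) (t : ℝ) : ℝ :=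
  ∫ s in (max (h k t) 0)..t, ∑ i, a i s

/-! Measure time by the clock `α t = ∫₀ᵗ ∑ a_k`. In clock time the coefficients sum to one, the
delays are eventually bounded by some `D`, and their weighted mean is at most `171/125`, a rational
slightly above `1 + 1/e`. It suffices to prove decay that is exponential in the clock and uniform in
`t₀`: the clock diverges, which gives asymptotic stability, and under the extra integral condition
it grows at least linearly, which gives exponential rates in `t`.

The core is `AfterZero.peak_le`: a solution bounded by `1` is at most `983/1000` on a positive
stretch after a sufficiently late zero `Z`. Let `w` be the clock time elapsed since `Z`. The slope
is at most `1`, so before `Z` the solution lies above `max (-1) w`, hence above every line through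
`(-1, -1)` with slope in `[0, 1]`. If such a line also minorizes the solution between `Z` and `t`,
the delayed average at `t` is at least the value of the line at the mean delayed clock time, because
affine functions commute with averaging. Take the chord from `(-1, -1)` to the current point. Either
it is a minorant, and the resulting differential inequality is controlled by a cubic and then a
constant barrier; or the solution has dipped below it, and a flatter line adapted to the deepest dip
bounds the current value (`AfterZero.dip_bound`).

Without a late zero, the solution has constant sign, becomes monotone in absolute value and halves.
So each clock period of length `3 * D + 2` contracts the bound by `983/1000`
(`EqClock.abs_le_or_decay`, `EqClock.abs_le_pow`), and a Grönwall estimate covers the initial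
stretch. -/

namespace AbsolutelyContinuousOnInterval

/-! ### Comparison principles for absolutely continuous functions. -/

/-- An absolutely continuous function with a.e. nonpositive derivative does not increase. -/
theorem le_of_ae_deriv_nonpos {f : ℝ → ℝ} {p q : ℝ} (hf : AbsolutelyContinuousOnInterval f p q)
    (hpq : p ≤ q) (hd : ∀ᵐ t, t ∈ Ioo p q → ∃ d, d ≤ 0 ∧ HasDerivAt f d t) : f q ≤ f p := by
  have h := hf.integral_deriv_eq_sub
  have : ∫ t in p..q, deriv f t ≤ 0 := by
    rw [intervalIntegral.integral_of_le hpq]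
    apply integral_nonpos_of_ae
    rw [← restrict_Ioo_eq_restrict_Ioc]
    filter_upwards [ae_restrict_of_ae hd, ae_restrict_mem measurableSet_Ioo] with t ht htm
    obtain ⟨d, hd0, hd⟩ := ht htm
    rw [hd.deriv]
    exact hd0
  linarith

/-- An absolutely continuous function that starts nonpositive and has nonpositive derivative
wherever it is positive stays nonpositive. -/
theorem nonpos_of_ae_deriv_nonpos {f : ℝ → ℝ} {p q : ℝ}
    (hf : AbsolutelyContinuousOnInterval f p q) (hpq : p ≤ q) (h0 : f p ≤ 0)
    (hd : ∀ᵐ t, t ∈ Ioo p q → 0 < f t → ∃ d, d ≤ 0 ∧ HasDerivAt f d t) : f q ≤ 0 := by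
  by_contra! hq
  have hc : ContinuousOn f (Icc p q) := by
    have := hf.continuousOn
    rwa [uIcc_of_le hpq] at this
  have hcpt : IsCompact (Icc p q ∩ f ⁻¹' Iic 0) :=
    isCompact_Icc.of_isClosed_subset (hc.preimage_isClosed_of_isClosed isClosed_Icc isClosed_Iic)
      inter_subset_left
  obtain ⟨s, ⟨hs, hs0⟩, hmax⟩ := hcpt.exists_isGreatest ⟨p, ⟨le_rfl, hpq⟩, h0⟩
  have h1 : f q ≤ f s := by
    apply (hf.mono (c := s) (d := q) _).le_of_ae_deriv_nonpos hs.2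
    · filter_upwards [hd] with t ht hts
      apply ht ⟨hs.1.trans_lt hts.1, hts.2⟩
      by_contra! hn
      exact absurd (hmax ⟨⟨hs.1.trans hts.1.le, hts.2.le⟩, hn⟩) (not_le.2 hts.1)
    · rw [uIcc_of_le hpq, uIcc_of_le hs.2]
      exact Icc_subset_Icc_left hs.1
  exact absurd (h1.trans hs0) (not_le.2 hq)

theorem comp_contDiff {f Φ : ℝ → ℝ} {p q : ℝ} (hf : AbsolutelyContinuousOnInterval f p q)
    (hΦ : ContDiff ℝ 1 Φ) : AbsolutelyContinuousOnInterval (fun t => Φ (f t)) p q := by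
  obtain ⟨C, hC⟩ := hf.exists_bound
  obtain ⟨K, hK⟩ := (hΦ.contDiffOn (s := Icc (-C) C)).exists_lipschitzOnWith one_ne_zero
    (convex_Icc _ _) isCompact_Icc
  rw [absolutelyContinuousOnInterval_iff] at hf ⊢
  intro ε hε
  -- `K + 1` rather than `K`, since the Lipschitz constant may vanish.
  obtain ⟨δ, hδ, h⟩ := hf (ε / (K + 1)) (by positivity)
  refine ⟨δ, hδ, fun E hE hlen => ?_⟩
  have h1 := h E hE hlen
  have hmem : ∀ x ∈ uIcc p q, f x ∈ Icc (-C) C := fun x hx => abs_le.1 (hC x hx)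
  have h2 : ∑ i ∈ Finset.range E.1, dist (Φ (f (E.2 i).1)) (Φ (f (E.2 i).2)) ≤
      ∑ i ∈ Finset.range E.1, (K + 1) * dist (f (E.2 i).1) (f (E.2 i).2) := by
    apply Finset.sum_le_sum
    intro i hi
    have hi' := hE.1 i hi
    refine (hK.dist_le_mul _ (hmem _ hi'.1) _ (hmem _ hi'.2)).trans ?_
    gcongr
    linarith
  rw [← Finset.mul_sum] at h2
  rw [lt_div_iff₀ (by positivity)] at h1
  linarith

end AbsolutelyContinuousOnInterval

/-! ### Slope bounds from affine minorants of the history. -/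

/-- The equation and its averaged-delay condition hold at time `t`. Delays are measured by a clock
`α` with rate `A = ∑ k, a k`, the weighted mean delay is at most `171 / 125`, and the delayed
arguments do not reach back beyond `T₀`. -/
structure GoodAt {m : ℕ} (a h : Fin m → ℝ → ℝ) (α A y : ℝ → ℝ) (T₀ t : ℝ) : Prop where
  clock : HasDerivAt α (A t) t
  eqn : HasDerivAt y (-∑ k, a k t * y (h k t)) t
  nonneg : ∀ k, 0 ≤ a k t
  sum_eq : ∑ k, a k t = A t
  mean : ∑ k, a k t * (α t - α (h k t)) ≤ 171 / 125 * A t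
  le : ∀ k, h k t ≤ t
  hist : ∀ k, T₀ ≤ h k t

namespace GoodAt

variable {m : ℕ} {a h : Fin m → ℝ → ℝ} {α A y : ℝ → ℝ} {T₀ t : ℝ}

theorem rate_nonneg (g : GoodAt a h α A y T₀ t) : 0 ≤ A t :=
  g.sum_eq ▸ Finset.sum_nonneg fun k _ => g.nonneg k

theorem const_mul (g : GoodAt a h α A y T₀ t) (c : ℝ) :
    GoodAt a h α A (fun s => c * y s) T₀ t where
  clock := g.clock
  eqn := by
    convert! g.eqn.const_mul c using 1
    rw [mul_neg, Finset.mul_sum]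
    congr 1
    exact Finset.sum_congr rfl fun k _ => by ring
  nonneg := g.nonneg
  sum_eq := g.sum_eq
  mean := g.mean
  le := g.le
  hist := g.hist

/-- Averaging an affine minorant over the delayed arguments evaluates it at the mean delayed clock
time. Since `μ ≥ 0`, only an upper bound on the mean delay is needed, not on the individual delays.
-/
theorem slope_le (g : GoodAt a h α A y T₀ t) {μ ν : ℝ} (hμ : 0 ≤ μ)
    (hy : ∀ p, T₀ ≤ p → p ≤ t → μ * α p + ν ≤ y p) :
    -∑ k, a k t * y (h k t) ≤ A t * (-(μ * (α t - 171 / 125) + ν)) := by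
  have h1 : ∑ k, a k t * (μ * α (h k t) + ν) ≤ ∑ k, a k t * y (h k t) :=
    Finset.sum_le_sum fun k _ =>
      mul_le_mul_of_nonneg_left (hy _ (g.hist k) (g.le k)) (g.nonneg k)
  have h2 : ∑ k, a k t * (μ * α (h k t) + ν) =
      (μ * α t + ν) * A t - μ * ∑ k, a k t * (α t - α (h k t)) := by
    rw [← g.sum_eq, Finset.mul_sum, Finset.mul_sum, ← Finset.sum_sub_distrib]
    exact Finset.sum_congr rfl fun k _ => by ring
  nlinarith [mul_le_mul_of_nonneg_left g.mean hμ]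

end GoodAt

/-- A solution bounded by `1` that vanishes at `Z` and is positive on `(Z, s]`, where the clock has
advanced by at least `1` since the equation became good. -/
structure AfterZero {m : ℕ} (a h : Fin m → ℝ → ℝ) (α A y : ℝ → ℝ) (T₀ T₁ Z s : ℝ) : Prop where
  mono : Monotone α
  cont : Continuous α
  clock_ac : ∀ p q, AbsolutelyContinuousOnInterval α p q
  ac : ∀ p q, T₁ ≤ p → p ≤ q → AbsolutelyContinuousOnInterval y p q
  good : ∀ᵐ t, T₁ ≤ t → GoodAt a h α A y T₀ t
  good_le : T₁ ≤ Z
  zero_le : Z ≤ s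
  one_le : α T₁ + 1 ≤ α Z
  bound : ∀ p, T₀ ≤ p → p ≤ s → |y p| ≤ 1
  zero : y Z = 0
  pos : ∀ p, Z < p → p ≤ s → 0 < y p

namespace AfterZero

variable {m : ℕ} {a h : Fin m → ℝ → ℝ} {α A y : ℝ → ℝ} {T₀ T₁ Z s : ℝ}

theorem sub_le (H : AfterZero a h α A y T₀ T₁ Z s) {Φ φ : ℝ → ℝ} (hΦ : ContDiff ℝ 1 Φ)
    (hφ : ∀ z, HasDerivAt Φ (φ z) z) {p q : ℝ} (hp : T₁ ≤ p) (hpq : p ≤ q)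
    (hs : ∀ t, t ∈ Ioo p q → GoodAt a h α A y T₀ t →
      -∑ k, a k t * y (h k t) ≤ A t * φ (α t)) :
    y q - y p ≤ Φ (α q) - Φ (α p) := by
  have := ((H.ac p q hp hpq).sub ((H.clock_ac p q).comp_contDiff hΦ)).le_of_ae_deriv_nonpos hpq
    (by
      filter_upwards [H.good] with t ht hts
      have g := ht (hp.trans hts.1.le)
      refine ⟨_, ?_, g.eqn.sub ((hφ (α t)).comp t g.clock)⟩
      have := hs t hts g
      linarith [mul_comm (A t) (φ (α t))])
  simp only [Pi.sub_apply] at this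
  linarith

theorem sub_le_clock (H : AfterZero a h α A y T₀ T₁ Z s) {p q : ℝ} (hp : T₁ ≤ p) (hpq : p ≤ q)
    (hq : q ≤ s) : y q - y p ≤ α q - α p := by
  refine H.sub_le (Φ := fun z => z) (φ := fun _ => 1) contDiff_id (fun z => hasDerivAt_id z)
    hp hpq fun t ht g => ?_
  -- The constant minorant `-1` gives slope at most `1` per unit of clock.
  have := g.slope_le (μ := 0) (ν := -1) le_rfl fun p hp hpt => by
    linarith [(abs_le.1 (H.bound p hp (hpt.trans (ht.2.le.trans hq)))).1]
  linarith

/-- The lower bound for the history before the zero. -/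
theorem clock_le (H : AfterZero a h α A y T₀ T₁ Z s) {p : ℝ} (hp : T₀ ≤ p) (hpZ : p ≤ Z) :
    α p - α Z ≤ y p := by
  rcases le_total p T₁ with h1 | h1
  -- Before `T₁` the slope bound is unavailable, but there the clock is at least `1` behind `Z`, so
  -- the bound `-1` suffices.
  · linarith [H.mono h1, H.one_le, (abs_le.1 (H.bound p hp (hpZ.trans H.zero_le))).1]
  · have := H.sub_le_clock h1 hpZ H.zero_le
    linarith [H.zero, this]

theorem nonneg (H : AfterZero a h α A y T₀ T₁ Z s) {p : ℝ} (hp : Z ≤ p) (hps : p ≤ s) :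
    0 ≤ y p := by
  rcases hp.eq_or_lt with rfl | h1
  · exact H.zero.ge
  · exact (H.pos p h1 hps).le

end AfterZero

/-! ### Numerical estimates for the dips and the barrier. -/

/-- As `μ = 1 / G`, the quadratic `u - μ * u ^ 2 / 2` is at most `G / 2`, and `G ≥ 1` leaves `46/125
+ 1/2 = 217/250`. For the second bound, flattening the line from slope `1` to `μ` costs `(1 - μ) * u
^ 2 / 2`, which the term `G - 1` pays for because `u ^ 2 ≤ 2`. -/
theorem early_dip_estimate {u G μ Y : ℝ} (hμ : 0 < μ) (hG : 1 ≤ G) (hμG : μ * G = 1)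
    (hY : Y ≤ u + 46 / 125 - (G - 1) - μ * u ^ 2 / 2) :
    Y ≤ 217 / 250 ∧ (0 ≤ u → u ≤ 7 / 5 → Y ≤ 46 / 125 + u - u ^ 2 / 2) := by
  constructor
  · have : 0 ≤ μ * (u - G) ^ 2 := by positivity
    have h2 : μ * (u - G) ^ 2 = μ * u ^ 2 - 2 * u * (μ * G) + G * (μ * G) := by ring
    rw [hμG] at h2
    linarith
  · intro hu0 hu
    have h1 : u ^ 2 ≤ 2 := by nlinarith
    have hμ1 : μ ≤ 1 := by nlinarith
    have h3 : (1 - μ) = μ * (G - 1) := by linarith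
    have h4 : μ * u ^ 2 ≤ 2 := by nlinarith [sq_nonneg u]
    have h5 : (1 - μ) * u ^ 2 ≤ 2 * (G - 1) := by
      rw [h3]
      nlinarith
    linarith

/-- Here `T` is the clock time since the dip. The chord rises by `K * T ≥ μ * T`, so the hypothesis
forces `r + T / 2 ≤ 46/125`: a late dip can only be recent and low, which gives `Y ≤ 46/125 + T /
2`. -/
theorem late_dip_estimate {K δ μ T r u Y : ℝ} (hμ : 0 < μ) (hμK : μ ≤ K) (hK : K ≤ 1)
    (hδ : 0 ≤ δ) (hT : 0 < T) (hr : 0 ≤ r) (hTu : T ≤ u)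
    (h : K * T + δ ≤ μ * T * (171 / 125 - r - T / 2)) (hY : Y = K * r + K * T + δ) :
    Y ≤ 217 / 250 ∧ (0 ≤ u → u ≤ 7 / 5 → Y ≤ 46 / 125 + u - u ^ 2 / 2) := by
  have h1 : r + T / 2 ≤ 46 / 125 := by
    have h2 : μ * T * 1 ≤ μ * T * (171 / 125 - r - T / 2) := by nlinarith
    have := le_of_mul_le_mul_left h2 (mul_pos hμ hT)
    linarith
  have h3 : μ * T * (171 / 125 - r - T / 2) ≤ 1 * T * (171 / 125 - r - T / 2) := by
    gcongr
    · linarith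
    · linarith
  have h4 : K * r ≤ r := by nlinarith
  have h5 : Y ≤ 46 / 125 + T / 2 := by nlinarith
  refine ⟨by linarith, fun _ _ => ?_⟩
  rcases le_total u 1 with h6 | h6
  · nlinarith
  · nlinarith

/-- The left side equals `(171/125 - u * y) / (u + 171/125)`, which does not increase with `y`; so
it is enough that the cubic is a supersolution, its derivative being the right side. -/
theorem barrier_slope {u y : ℝ} (hu : 0 ≤ u)
    (hy : 46 / 125 + u - u ^ 2 / 2 + 71 / 1000 * u ^ 3 < y) :
    171 / 125 * (1 + y) / (u + 171 / 125) - y ≤ 1 - u + 213 / 1000 * u ^ 2 := by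
  have h1 : (0 : ℝ) < u + 171 / 125 := by linarith
  rw [sub_le_iff_le_add, div_le_iff₀ h1]
  have h2 : u * (46 / 125 + u - u ^ 2 / 2 + 71 / 1000 * u ^ 3) ≤ u * y :=
    mul_le_mul_of_nonneg_left hy.le hu
  nlinarith [mul_nonneg (sq_nonneg u) (sq_nonneg (u - 2)), sq_nonneg u,
    mul_nonneg (sq_nonneg u) (sq_nonneg (u - 3)), mul_nonneg (sq_nonneg u) hu]

theorem barrier_le {u : ℝ} (hu : 0 ≤ u) (hu' : u ≤ 7 / 5) :
    46 / 125 + u - u ^ 2 / 2 + 71 / 1000 * u ^ 3 ≤ 983 / 1000 := by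
  nlinarith [mul_nonneg (sub_nonneg.2 hu') hu, sq_nonneg (u - 7 / 5),
    mul_nonneg (sq_nonneg (u - 7 / 5)) hu]

/-! ### The peak after a zero. -/

namespace AfterZero

variable {m : ℕ} {a h : Fin m → ℝ → ℝ} {α A y : ℝ → ℝ} {T₀ T₁ Z s : ℝ}

/-- A line through `(-1, -1)` with slope in `[0, 1]` lies below the history before `Z`
automatically, so it has to be checked only between `Z` and `t`. -/
theorem slope_le (H : AfterZero a h α A y T₀ T₁ Z s) {t μ : ℝ} (g : GoodAt a h α A y T₀ t)
    (hμ : 0 ≤ μ) (hμ1 : μ ≤ 1) (hts : t ≤ s)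
    (hy : ∀ p, Z ≤ p → p ≤ t → μ * (α p - α Z + 1) - 1 ≤ y p) :
    -∑ k, a k t * y (h k t) ≤ A t * (1 - μ * (α t - α Z + 1 - 171 / 125)) := by
  have := g.slope_le (μ := μ) (ν := μ * (1 - α Z) - 1) hμ fun p hp hpt => by
    rcases le_total p Z with h1 | h1
    · have h2 := H.clock_le hp h1
      have h3 := (abs_le.1 (H.bound p hp (hpt.trans hts))).1
      rcases le_total (α p - α Z + 1) 0 with h4 | h4
      · nlinarith
      · nlinarith
    · linarith [hy p h1 hpt]
  refine this.trans_eq ?_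
  ring

/-- If the solution drops below the chord that ends at time `t`, then its value at `t` is small. -/
theorem dip_bound (H : AfterZero a h α A y T₀ T₁ Z s) {t p : ℝ} (hZt : Z < t) (hts : t ≤ s)
    (hZp : Z ≤ p) (hpt : p ≤ t) (hu : 46 / 125 ≤ α t - α Z)
    (hdip : y p < (1 + y t) / (1 + (α t - α Z)) * (α p - α Z + 1) - 1) :
    y t ≤ 217 / 250 ∧ (0 ≤ α t - α Z - 46 / 125 → α t - α Z - 46 / 125 ≤ 7 / 5 →
      y t ≤ 46 / 125 + (α t - α Z - 46 / 125) - (α t - α Z - 46 / 125) ^ 2 / 2) := by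
  have hy0 := H.pos t hZt hts
  have hw := H.sub_le_clock H.good_le hZt.le hts
  rw [H.zero, sub_zero] at hw
  set w := α t - α Z with hwdef
  set K := (1 + y t) / (1 + w) with hKdef
  have hKw : K * (w + 1) - 1 = y t := by
    rw [hKdef]
    field_simp
    ring
  have hK1 : K ≤ 1 := by
    rw [hKdef, div_le_one (by linarith)]
    linarith
  have hK0 : 0 < K := by
    rw [hKdef]
    apply div_pos <;> linarith
  have hyc : ContinuousOn (fun q => y q - (K * (α q - α Z + 1) - 1)) (Icc Z t) := by
    have := (H.ac Z t H.good_le hZt.le).continuousOn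
    rw [uIcc_of_le hZt.le] at this
    have := H.cont
    fun_prop
  -- `x` is the deepest point below the chord and `δ` its depth, so the chord lowered by `δ` is a
  -- minorant on `[Z, t]`.
  obtain ⟨x, ⟨hZx, hxt⟩, hxmin⟩ := isCompact_Icc.exists_isMinOn ⟨Z, le_rfl, hZt.le⟩ hyc
  obtain ⟨δ, hδ⟩ : ∃ δ, δ = -(y x - (K * (α x - α Z + 1) - 1)) := ⟨_, rfl⟩
  have hmin : ∀ q, Z ≤ q → q ≤ t → K * (α q - α Z + 1) - 1 - δ ≤ y q := fun q h1 h2 => by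
    have := hxmin (show q ∈ Icc Z t from ⟨h1, h2⟩)
    simp only [mem_ofPred_eq] at this
    linarith
  have hδ0 : 0 < δ := by linarith [hmin p hZp hpt]
  have hxt' : x < t := by
    refine lt_of_le_of_ne hxt fun h => ?_
    rw [h, ← hwdef, hKw] at hδ
    linarith
  have hyx : 0 ≤ y x := H.nonneg hZx (hxt.trans hts)
  set ξ := α x - α Z with hξ
  have hξw : ξ ≤ w := by linarith [H.mono hxt]
  -- The line through `(-1, -1)` with slope `μ` crosses zero where the lowered chord does, at clock
  -- time `G - 1` after `Z`.
  obtain ⟨μ, hμ⟩ : ∃ μ, μ = K / (1 + δ) := ⟨_, rfl⟩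
  obtain ⟨G, hG⟩ : ∃ G, G = (1 + δ) / K := ⟨_, rfl⟩
  have hμ0 : 0 < μ := by rw [hμ]; positivity
  have hμK' : μ * (1 + δ) = K := by rw [hμ]; field_simp
  have hμK : μ ≤ K := by nlinarith
  have hKG : K * G = 1 + δ := by rw [hG]; field_simp
  have hμG : μ * G = 1 := by rw [hμ, hG]; field_simp
  have hG1 : 1 ≤ G := by nlinarith
  have hξG : G ≤ ξ + 1 := by
    have : K * G ≤ K * (ξ + 1) := by linarith
    exact le_of_mul_le_mul_left this hK0
  have hQ : ∀ q, x ≤ q → q ≤ t → y t - y q ≤ (w - μ * (w + 1 - 171 / 125) ^ 2 / 2) -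
      ((α q - α Z) - μ * (α q - α Z + 1 - 171 / 125) ^ 2 / 2) := fun q hxq hqt => by
    refine H.sub_le (Φ := fun z => z - α Z - μ * (z - α Z + 1 - 171 / 125) ^ 2 / 2)
      (φ := fun z => 1 - μ * (z - α Z + 1 - 171 / 125)) (by fun_prop) (fun z => ?_)
      (H.good_le.trans (hZx.trans hxq)) hqt fun r hr g => ?_
    · have h1 : HasDerivAt (fun z => z - α Z) 1 z := (hasDerivAt_id z).sub_const _
      have h2 := h1.sub ((((h1.add_const 1).sub_const (171 / 125)).pow 2).const_mul μ |>.div_const 2)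
      convert! h2 using 1
      simp
      ring
    · refine H.slope_le g hμ0.le (hμK.trans hK1) (hr.2.le.trans hts) fun p' hp1 hp2 => ?_
      -- Where the new line is nonpositive, `y ≥ 0` suffices; where it is positive, it lies below
      -- the lowered chord, which is `1 + δ` times as high.
      rcases le_total (μ * (α p' - α Z + 1)) 1 with h3 | h3
      · linarith [H.nonneg hp1 (hp2.trans (hr.2.le.trans hts))]
      · have h4 := hmin p' hp1 (hp2.trans hr.2.le)
        rw [← hμK'] at h4
        nlinarith
  have hyx' : y x = K * (ξ + 1) - 1 - δ := by linarith
  -- At clock time `46/125` after `Z` the quadratic slope bound falls to `1`. For an earlier dip the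
  -- unit slope bound is the better one up to that time; for a later dip the quadratic bound is used
  -- from `x` on.
  rcases lt_or_ge ξ (46 / 125) with hc | hc
  · obtain ⟨q, ⟨hxq, hqt⟩, hq⟩ : ∃ q ∈ Icc x t, α q = α Z + 46 / 125 :=
      intermediate_value_Icc hxt H.cont.continuousOn ⟨by linarith, by linarith⟩
    have h1 := hQ q hxq hqt
    have h2 := H.sub_le_clock (H.good_le.trans hZx) hxq (hqt.trans hts)
    rw [hq] at h1 h2
    refine early_dip_estimate hμ0 hG1 hμG ?_
    have h3 : K * (ξ + 1 - G) ≤ 1 * (ξ + 1 - G) :=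
      mul_le_mul_of_nonneg_right hK1 (by linarith)
    have h4 : (w + 1 - 171 / 125) = w - 46 / 125 := by ring
    rw [h4] at h1
    have h5 : (α Z + 46 / 125 - α Z + 1 - 171 / 125) = 0 := by ring
    rw [h5] at h1
    linarith
  · have h1 := hQ x le_rfl hxt
    have hT : 0 < w - ξ := by
      refine lt_of_le_of_ne (by linarith) fun h => ?_
      have : w = ξ := by linarith
      rw [← hξ, ← this] at h1
      have h6 : K * (w + 1) = K * (ξ + 1) := by rw [this]
      linarith
    refine late_dip_estimate (T := w - ξ) (r := ξ + 1 - G) hμ0 hμK hK1 hδ0.le hT (by linarith)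
      (by linarith) ?_ (by linarith)
    have h7 : μ * (w - ξ) * (171 / 125 - (ξ + 1 - G) - (w - ξ) / 2) =
        (w - μ * (w + 1 - 171 / 125) ^ 2 / 2) - (ξ - μ * (ξ + 1 - 171 / 125) ^ 2 / 2) := by
      linear_combination (w - ξ) * hμG
    rw [h7]
    rw [← hξ] at h1
    linarith

/-- Without a dip, the slope is bounded by the value. -/
theorem slope_le_of_value (H : AfterZero a h α A y T₀ T₁ Z s) {t : ℝ}
    (g : GoodAt a h α A y T₀ t) (hZt : Z < t) (hts : t ≤ s)
    (hno : ∀ p, Z ≤ p → p ≤ t → (1 + y t) / (1 + (α t - α Z)) * (α p - α Z + 1) - 1 ≤ y p) :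
    -∑ k, a k t * y (h k t) ≤
      A t * (171 / 125 * (1 + y t) / (1 + (α t - α Z)) - y t) := by
  have hy0 := H.pos t hZt hts
  have hw := H.sub_le_clock H.good_le hZt.le hts
  rw [H.zero, sub_zero] at hw
  have := H.slope_le g (div_nonneg (by linarith) (by linarith))
    ((div_le_one (by linarith)).2 (by linarith)) hts hno
  refine this.trans_eq ?_
  have : 1 + (α t - α Z) ≠ 0 := by linarith
  field_simp
  ring

/-- Unit slope up to clock time `46/125` after `Z`, then the cubic barrier for `7/5` more, then a
constant. Above a barrier a dip is impossible by `dip_bound`, so the chord inequality applies there.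
-/
theorem peak_le (H : AfterZero a h α A y T₀ T₁ Z s) : y s ≤ 983 / 1000 := by
  have hup := H.sub_le_clock H.good_le H.zero_le le_rfl
  rw [H.zero, sub_zero] at hup
  rcases le_total (α s - α Z) (46 / 125) with h0 | h0
  · linarith
  obtain ⟨q₁, ⟨hZq, hqs⟩, hq₁⟩ : ∃ q ∈ Icc Z s, α q = α Z + 46 / 125 :=
    intermediate_value_Icc H.zero_le H.cont.continuousOn ⟨by linarith, by linarith⟩
  have hZq' : Z < q₁ := by
    refine lt_of_le_of_ne hZq fun h => ?_
    rw [← h] at hq₁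
    linarith
  have hyq := H.sub_le_clock H.good_le hZq hqs
  rw [H.zero, sub_zero, hq₁] at hyq
  -- The quadratic part is the bound after a dip; the cubic term makes `W` a supersolution of the
  -- chord inequality while keeping `W (7/5)` just below `983/1000`.
  set W : ℝ → ℝ := fun u => 46 / 125 + u - u ^ 2 / 2 + 71 / 1000 * u ^ 3 with hW
  have stage1 : ∀ q, q₁ ≤ q → q ≤ s → α q - α Z - 46 / 125 ≤ 7 / 5 →
      y q ≤ W (α q - α Z - 46 / 125) := by
    intro q h1 h2 h3
    have hΦ : ContDiff ℝ 1 (fun z => W (z - α Z - 46 / 125)) := by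
      simp only [hW]
      fun_prop
    have := ((H.ac q₁ q (H.good_le.trans hZq) h1).sub
      ((H.clock_ac q₁ q).comp_contDiff hΦ)).nonpos_of_ae_deriv_nonpos h1 (by
        simp only [Pi.sub_apply, hW, hq₁]
        norm_num
        linarith) (by
        filter_upwards [H.good] with t ht htm hpos
        have g := ht (H.good_le.trans (hZq.trans htm.1.le))
        have hts := htm.2.le.trans h2
        have hZt := hZq'.trans htm.1
        have hu0 : 0 ≤ α t - α Z - 46 / 125 := by linarith [H.mono htm.1.le]
        have hu1 : α t - α Z - 46 / 125 ≤ 7 / 5 := by linarith [H.mono htm.2.le]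
        set u := α t - α Z - 46 / 125 with hu
        have hd : HasDerivAt W (1 - u + 213 / 1000 * u ^ 2) u := by
          have h1 := ((hasDerivAt_id u).const_add (46 / 125)).sub
            (((hasDerivAt_id u).pow 2).div_const 2) |>.add
            (((hasDerivAt_id u).pow 3).const_mul (71 / 1000))
          convert! h1 using 1
          simp
          ring
        simp only [Pi.sub_apply] at hpos
        have hd' : HasDerivAt (fun t => W (α t - α Z - 46 / 125))
            ((1 - u + 213 / 1000 * u ^ 2) * A t) t :=
          HasDerivAt.comp (h := fun t => α t - α Z - 46 / 125) (h₂ := W) t hd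
            ((g.clock.sub_const (α Z)).sub_const (46 / 125))
        refine ⟨_, ?_, g.eqn.sub hd'⟩
        have hsl := H.slope_le_of_value g hZt hts fun p hp1 hp2 => by
          by_contra! hdip
          have := (H.dip_bound hZt hts hp1 hp2 (by linarith) hdip).2 hu0 hu1
          have h3 : 0 ≤ u ^ 3 := by positivity
          simp only [hW] at hpos
          rw [← hu] at hpos this
          linarith
        have hb := barrier_slope hu0 (sub_pos.1 hpos)
        have hden : 1 + (α t - α Z) = u + 171 / 125 := by rw [hu]; ring
        rw [hden] at hsl
        have := mul_le_mul_of_nonneg_left hb g.rate_nonneg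
        linarith [mul_comm (A t) (1 - u + 213 / 1000 * u ^ 2)])
    simp only [Pi.sub_apply] at this
    linarith
  rcases le_total (α s - α Z - 46 / 125) (7 / 5) with h1 | h1
  · exact (stage1 s hqs le_rfl h1).trans (barrier_le (by linarith) h1)
  obtain ⟨q₂, ⟨hqq, hqs₂⟩, hq₂⟩ : ∃ q ∈ Icc q₁ s, α q = α Z + 46 / 125 + 7 / 5 :=
    intermediate_value_Icc hqs H.cont.continuousOn ⟨by linarith, by linarith⟩
  have hy₂ := (stage1 q₂ hqq hqs₂ (by linarith)).trans (barrier_le (by linarith) (by linarith))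
  have := ((H.ac q₂ s (H.good_le.trans (hZq.trans hqq)) hqs₂).sub
    ((LipschitzWith.const (983 / 1000 : ℝ)).lipschitzOnWith.absolutelyContinuousOnInterval
      )).nonpos_of_ae_deriv_nonpos hqs₂ (by
        simp only [Pi.sub_apply]
        linarith) (by
        filter_upwards [H.good] with t ht htm hpos
        have g := ht (H.good_le.trans (hZq.trans (hqq.trans htm.1.le)))
        have hts := htm.2.le
        have hZt := hZq'.trans_le (hqq.trans htm.1.le)
        have hu1 : 7 / 5 ≤ α t - α Z - 46 / 125 := by linarith [H.mono htm.1.le]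
        simp only [Pi.sub_apply] at hpos
        refine ⟨_, ?_, g.eqn.sub (hasDerivAt_const t _)⟩
        have hsl := H.slope_le_of_value g hZt hts fun p hp1 hp2 => by
          by_contra! hdip
          have := (H.dip_bound hZt hts hp1 hp2 (by linarith) hdip).1
          linarith
        -- The denominator is now at least `346/125`, so the expression is nonpositive once `y t ≥
        -- 171/175`, which is below `983/1000`.
        have hden : 171 / 125 * (1 + y t) / (1 + (α t - α Z)) - y t ≤ 0 := by
          rw [sub_nonpos, div_le_iff₀ (by linarith)]
          nlinarith
        nlinarith [g.rate_nonneg])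
  simp only [Pi.sub_apply] at this
  linarith

end AfterZero

/-! ### From the peak bound to exponential decay in the clock. -/

/-- A clock `α` with rate `A = ∑ k, a k` that tends to infinity. After time `T` the delays measured
by the clock are less than `D` and have weighted mean at most `171 / 125`. -/
structure EqClock {m : ℕ} (a h : Fin m → ℝ → ℝ) (α A : ℝ → ℝ) (D T : ℝ) : Prop where
  mono : Monotone α
  cont : Continuous α
  clock_ac : ∀ p q, AbsolutelyContinuousOnInterval α p q
  tendsto : Tendsto α atTop atTop
  clock_nonneg : ∀ t, 0 ≤ α t
  delay_pos : 0 < D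
  start_nonneg : 0 ≤ T
  clock_deriv : ∀ᵐ t, 0 ≤ t → HasDerivAt α (A t) t
  coeff_nonneg : ∀ᵐ t, 0 ≤ t → ∀ k, 0 ≤ a k t
  sum_eq : ∀ t, 0 ≤ t → ∑ k, a k t = A t
  le : ∀ k t, 0 ≤ t → h k t ≤ t
  mean : ∀ᵐ t, T ≤ t → ∑ k, a k t * (α t - α (h k t)) ≤ 171 / 125 * A t
  delay : ∀ᵐ t, T ≤ t → ∀ k, α t - α (h k t) < D

namespace IsSolution

variable {m : ℕ} {a h : Fin m → ℝ → ℝ} {φ y : ℝ → ℝ} {t₀ x₀ : ℝ}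

theorem ac (S : IsSolution a h t₀ φ x₀ y) {p q : ℝ} (hp : t₀ ≤ p) (hpq : p ≤ q) :
    AbsolutelyContinuousOnInterval y p q :=
  (S.absCont q (hp.trans hpq)).mono (by
    rw [uIcc_of_le hpq, uIcc_of_le (hp.trans hpq)]
    exact Icc_subset_Icc_left hp)

theorem continuousOn (S : IsSolution a h t₀ φ x₀ y) {p q : ℝ} (hp : t₀ ≤ p) (hpq : p ≤ q) :
    ContinuousOn y (Icc p q) := by
  have := (S.ac hp hpq).continuousOn
  rwa [uIcc_of_le hpq] at this

theorem ae_eqn (S : IsSolution a h t₀ φ x₀ y) :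
    ∀ᵐ t, t₀ ≤ t → HasDerivAt y (-∑ k, a k t * y (h k t)) t :=
  (ae_restrict_iff' measurableSet_Ici).1 S.equation

end IsSolution

/-- A function continuous and without zeros on an interval has constant sign there. -/
theorem pos_of_ne_zero_of_pos {f : ℝ → ℝ} {p q : ℝ} (hf : ContinuousOn f (Icc p q))
    (hne : ∀ t, p ≤ t → t ≤ q → f t ≠ 0) (hq : 0 < f q) : ∀ t, p ≤ t → t ≤ q → 0 < f t := by
  intro t hpt htq
  by_contra! hn
  obtain ⟨r, ⟨h1, h2⟩, hr⟩ := intermediate_value_Icc htq (hf.mono (Icc_subset_Icc_left hpt))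
    (show (0 : ℝ) ∈ Icc (f t) (f q) from ⟨hn, hq.le⟩)
  exact hne r (hpt.trans h1) h2 hr

namespace EqClock

variable {m : ℕ} {a h : Fin m → ℝ → ℝ} {α A : ℝ → ℝ} {D T : ℝ}

theorem exists_eq (E : EqClock a h α A D T) {s v : ℝ} (hv : α s ≤ v) : ∃ t, s ≤ t ∧ α t = v := by
  obtain ⟨b, hb⟩ := ((E.tendsto.eventually_ge_atTop v).and (eventually_ge_atTop s)).exists
  obtain ⟨t, ht, htv⟩ := intermediate_value_Icc hb.2 E.cont.continuousOn ⟨hv, hb.1⟩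
  exact ⟨t, ht.1, htv⟩

theorem lt_of_lt (E : EqClock a h α A D T) {p q : ℝ} (hpq : α p < α q) : p < q :=
  lt_of_not_ge fun h => absurd (E.mono h) (not_le.2 hpq)

theorem good (E : EqClock a h α A D T) {y φ : ℝ → ℝ} {t₀ x₀ s T₁ : ℝ}
    (S : IsSolution a h t₀ φ x₀ y) (ht₀ : 0 ≤ t₀) (hs : t₀ ≤ s) (hTs : T ≤ s)
    (h1 : α s + D ≤ α T₁) : ∀ᵐ t, T₁ ≤ t → GoodAt a h α A y s t := by
  have hsT : s < T₁ := E.lt_of_lt (by linarith [E.delay_pos])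
  filter_upwards [S.ae_eqn, E.clock_deriv, E.coeff_nonneg, E.mean, E.delay]
    with t e1 e2 e3 e4 e5 ht
  have hst : s < t := hsT.trans_le ht
  have ht0 : 0 ≤ t := by linarith
  exact ⟨e2 ht0, e1 (by linarith), e3 ht0, E.sum_eq t ht0, e4 (by linarith), fun k => E.le k t ht0,
    fun k => (E.lt_of_lt (by linarith [e5 (by linarith) k, E.mono ht])).le⟩

/-- After a zero, a solution bounded by `M` is bounded by `983 / 1000 * M`. -/
theorem abs_le_of_zero (E : EqClock a h α A D T) {y φ : ℝ → ℝ} {t₀ x₀ s t Z M : ℝ}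
    (S : IsSolution a h t₀ φ x₀ y) (ht₀ : 0 ≤ t₀) (hs : t₀ ≤ s) (hTs : T ≤ s) (hM : 0 < M)
    (hbd : ∀ p, s ≤ p → p ≤ t → |y p| ≤ M) (hZ : α s + D + 1 ≤ α Z) (hZt : Z ≤ t)
    (hyZ : y Z = 0) : |y t| ≤ 983 / 1000 * M := by
  have hsZ : s < Z := E.lt_of_lt (by linarith [E.delay_pos])
  rcases eq_or_ne (y t) 0 with h0 | h0
  · rw [h0, abs_zero]
    positivity
  have hc : ContinuousOn y (Icc Z t) := S.continuousOn (by linarith) hZt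
  have hcpt : IsCompact (Icc Z t ∩ y ⁻¹' {0}) :=
    isCompact_Icc.of_isClosed_subset (hc.preimage_isClosed_of_isClosed isClosed_Icc
      isClosed_singleton) inter_subset_left
  -- `r` is the last zero before `t`; the factor `c = ±1 / M` makes the solution positive after `r`
  -- and bounded by `1`.
  obtain ⟨r, ⟨⟨hZr, hrt⟩, hr0⟩, hmax⟩ := hcpt.exists_isGreatest ⟨Z, ⟨le_rfl, hZt⟩, hyZ⟩
  obtain ⟨c, hcM, hct⟩ : ∃ c : ℝ, |c| = 1 / M ∧ 0 < c * y t := by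
    rcases h0.lt_or_gt with h | h
    · refine ⟨-(1 / M), by rw [abs_neg, abs_of_pos (by positivity)], ?_⟩
      have : 0 < 1 / M := by positivity
      nlinarith
    · exact ⟨1 / M, abs_of_pos (by positivity), by positivity⟩
  have hc0 : c ≠ 0 := by
    rintro rfl
    simp at hct
  obtain ⟨T₁, hsT, hT₁⟩ := E.exists_eq (show α s ≤ α s + D by linarith [E.delay_pos])
  have hT₁Z : T₁ < Z := E.lt_of_lt (by linarith)
  have H : AfterZero a h α A (fun p => c * y p) s T₁ r t :=
    { mono := E.mono
      cont := E.cont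
      clock_ac := E.clock_ac
      ac := fun p q hp hpq => (S.ac (by linarith) hpq).const_mul c
      good := by
        filter_upwards [E.good S ht₀ hs hTs hT₁.ge] with p hp h1
        exact (hp h1).const_mul c
      good_le := hT₁Z.le.trans hZr
      zero_le := hrt
      one_le := by linarith [E.mono hZr]
      bound := fun p hp hpt => by
        rw [abs_mul, hcM, one_div, inv_mul_le_iff₀ hM, mul_one]
        exact hbd p hp hpt
      zero := by
        rw [show y r = 0 from hr0, mul_zero]
      pos := fun p hp hpt => by
        refine pos_of_ne_zero_of_pos (f := fun p => c * y p) (p := p) (q := t) ?_ ?_ hct p le_rfl hpt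
        · exact continuousOn_const.mul (hc.mono (Icc_subset_Icc_left (hZr.trans hp.le)))
        · intro q hpq hqt hq0
          have hq : y q = 0 := by simpa [hc0] using hq0
          exact absurd (hmax ⟨⟨hZr.trans (hp.le.trans hpq), hqt⟩, hq⟩)
            (not_le.2 (hp.trans_le hpq)) }
  have h1 := H.peak_le
  have h2 : |c * y t| ≤ 983 / 1000 := by rwa [abs_of_pos hct]
  rw [abs_mul, hcM, one_div, inv_mul_le_iff₀ hM] at h2
  linarith

/-- A solution that stays positive decreases, and halves within a fixed clock time. -/
theorem decay_of_pos (E : EqClock a h α A D T) {z : ℝ → ℝ} {r t M : ℝ}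
    (hac : ∀ p q, r ≤ p → p ≤ q → AbsolutelyContinuousOnInterval z p q)
    (heq : ∀ᵐ t, r ≤ t → HasDerivAt z (-∑ k, a k t * z (h k t)) t) (hTr : T ≤ r)
    (hpos : ∀ p, r ≤ p → p ≤ t → 0 < z p) (hbd : ∀ p, r ≤ p → p ≤ t → z p ≤ M) :
    (∀ q, q ≤ t → α r + D ≤ α q → z t ≤ z q) ∧ (α r + 2 * D + 1 ≤ α t → z t ≤ M / 2) := by
  have hr0 : 0 ≤ r := E.start_nonneg.trans hTr
  have hmono : ∀ q, q ≤ t → α r + D ≤ α q → z t ≤ z q := by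
    intro q hqt hq
    have hrq : r < q := E.lt_of_lt (by linarith [E.delay_pos])
    refine (hac q t hrq.le hqt).le_of_ae_deriv_nonpos hqt ?_
    filter_upwards [heq, E.coeff_nonneg, E.delay] with p e1 e2 e3 hp
    have hrp : r < p := hrq.trans hp.1
    refine ⟨_, ?_, e1 hrp.le⟩
    rw [neg_nonpos]
    refine Finset.sum_nonneg fun k _ => mul_nonneg (e2 (by linarith) k) (hpos _ ?_ ?_).le
    · exact (E.lt_of_lt (by linarith [e3 (by linarith) k, E.mono hp.1.le])).le
    · exact (E.le k p (by linarith)).trans hp.2.le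
  refine ⟨hmono, fun ht => ?_⟩
  -- After `f` the delayed arguments lie where `z` is already monotone, so delayed values are at
  -- least `z t`. Hence `z + z t * α` does not increase on `[f, t]`, and one unit of clock gives `2
  -- * z t ≤ z f`.
  obtain ⟨f, hrf, hf⟩ := E.exists_eq (show α r ≤ α r + 2 * D by linarith [E.delay_pos])
  have hft : f < t := E.lt_of_lt (by linarith)
  have := ((hac f t hrf hft.le).add ((E.clock_ac f t).const_mul (z t))).le_of_ae_deriv_nonpos hft.le
    (by
      filter_upwards [heq, E.coeff_nonneg, E.delay, E.clock_deriv] with p e1 e2 e3 e4 hp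
      have hrp : r < p := hrf.trans_lt hp.1
      refine ⟨_, ?_, (e1 hrp.le).add ((e4 (by linarith)).const_mul (z t))⟩
      have h1 : ∑ k, a k p * z t ≤ ∑ k, a k p * z (h k p) := by
        refine Finset.sum_le_sum fun k _ => mul_le_mul_of_nonneg_left (hmono _ ?_ ?_)
          (e2 (by linarith) k)
        · exact (E.le k p (by linarith)).trans hp.2.le
        · linarith [e3 (by linarith) k, E.mono hp.1.le]
      rw [← Finset.sum_mul, E.sum_eq p (by linarith)] at h1
      linarith)
  simp only [Pi.add_apply] at this
  have h2 := hbd f hrf hft.le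
  have h3 := hpos t (hrf.trans hft.le) le_rfl
  nlinarith

/-- The alternatives are a zero at clock time at least `D + 1` after `s`, where the peak bound
applies, or constant sign from then on. The monotonicity clause serves `abs_le_of_abs_le`, the
halving clause `abs_le_pow`. -/
theorem abs_le_or_decay (E : EqClock a h α A D T) {y φ : ℝ → ℝ} {t₀ x₀ s t M : ℝ}
    (S : IsSolution a h t₀ φ x₀ y) (ht₀ : 0 ≤ t₀) (hs : t₀ ≤ s) (hTs : T ≤ s) (hM : 0 < M)
    (hbd : ∀ p, s ≤ p → p ≤ t → |y p| ≤ M) :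
    |y t| ≤ 983 / 1000 * M ∨ ((∀ q, q ≤ t → α s + 2 * D + 1 ≤ α q → |y t| ≤ |y q|) ∧
      (α s + 3 * D + 2 ≤ α t → |y t| ≤ M / 2)) := by
  have hD := E.delay_pos
  obtain ⟨r, hsr, hr⟩ := E.exists_eq (show α s ≤ α s + D + 1 by linarith)
  rcases lt_or_ge t r with htr | hrt
  · have := E.mono htr.le
    exact Or.inr ⟨fun q h1 h2 => by linarith [E.mono h1], fun h1 => by linarith⟩
  by_cases hz : ∃ Z, r ≤ Z ∧ Z ≤ t ∧ y Z = 0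
  · obtain ⟨Z, h1, h2, h3⟩ := hz
    exact Or.inl (E.abs_le_of_zero S ht₀ hs hTs hM hbd (by linarith [E.mono h1]) h2 h3)
  push Not at hz
  right
  obtain ⟨c, hc1, hct⟩ : ∃ c : ℝ, |c| = 1 ∧ 0 < c * y t := by
    rcases (hz t hrt le_rfl).lt_or_gt with h | h
    · exact ⟨-1, by simp, by linarith⟩
    · exact ⟨1, by simp, by linarith⟩
  have hc0 : c ≠ 0 := by
    rintro rfl
    simp at hc1
  have hpos : ∀ p, r ≤ p → p ≤ t → 0 < c * y p :=
    pos_of_ne_zero_of_pos (continuousOn_const.mul (S.continuousOn (by linarith) hrt))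
      (fun p h1 h2 => mul_ne_zero hc0 (hz p h1 h2)) hct
  have habs : ∀ p, r ≤ p → p ≤ t → |y p| = c * y p := fun p h1 h2 => by
    rw [← abs_of_pos (hpos p h1 h2), abs_mul, hc1, one_mul]
  have := E.decay_of_pos (z := fun p => c * y p) (r := r) (t := t) (M := M)
    (fun p q hp hpq => (S.ac (by linarith) hpq).const_mul c)
    (by
      filter_upwards [S.ae_eqn] with p hp h1
      convert! (hp (by linarith)).const_mul c using 1
      rw [mul_neg, Finset.mul_sum]
      congr 1
      exact Finset.sum_congr rfl fun k _ => by ring)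
    (by linarith) hpos (fun p h1 h2 => (habs p h1 h2) ▸ hbd p (by linarith) h2)
  rw [← habs t hrt le_rfl] at this
  refine ⟨fun q hqt hq => ?_, fun h1 => this.2 (by linarith)⟩
  have hrq : r < q := E.lt_of_lt (by linarith)
  exact (this.1 q hqt (by linarith)).trans_eq (habs q hrq.le hqt).symm

/-- At a maximum of `|y|` on `[s, t]` exceeding `M`, contraction by `983/1000` is absurd, and
monotonicity carries the maximum back to the initial window, where `M` is a bound. -/
theorem abs_le_of_abs_le (E : EqClock a h α A D T) {y φ : ℝ → ℝ} {t₀ x₀ s M : ℝ}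
    (S : IsSolution a h t₀ φ x₀ y) (ht₀ : 0 ≤ t₀) (hs : t₀ ≤ s) (hTs : T ≤ s) (hM : 0 < M)
    (hbd : ∀ p, s ≤ p → α p ≤ α s + 2 * D + 1 → |y p| ≤ M) : ∀ t, s ≤ t → |y t| ≤ M := by
  intro t hst
  by_contra! hlt
  obtain ⟨r, ⟨hsr, hrt⟩, hmax⟩ := isCompact_Icc.exists_isMaxOn ⟨t, hst, le_rfl⟩
    (S.continuousOn hs hst).abs
  have hMr : M < |y r| := hlt.trans_le (hmax ⟨hst, le_rfl⟩)
  rcases E.abs_le_or_decay S ht₀ hs hTs (hM.trans hMr)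
    (fun p h1 h2 => hmax ⟨h1, h2.trans hrt⟩) with h | h
  · linarith
  · obtain ⟨q, hsq, hq⟩ := E.exists_eq (show α s ≤ α s + 2 * D + 1 by linarith [E.delay_pos])
    rcases le_total q r with h1 | h1
    · linarith [h.1 q h1 hq.ge, hbd q hsq hq.le]
    · linarith [hbd r hsr ((E.mono h1).trans hq.le)]

theorem abs_le_pow (E : EqClock a h α A D T) {y φ : ℝ → ℝ} {t₀ x₀ s M : ℝ}
    (S : IsSolution a h t₀ φ x₀ y) (ht₀ : 0 ≤ t₀) (hs : t₀ ≤ s) (hTs : T ≤ s) (hM : 0 < M)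
    (hbd : ∀ p, s ≤ p → |y p| ≤ M) (n : ℕ) :
    ∀ t, s ≤ t → α s + n * (3 * D + 2) ≤ α t → |y t| ≤ (983 / 1000) ^ n * M := by
  induction n with
  | zero => intro t hst _; simpa using hbd t hst
  | succ n ih =>
    intro t hst ht
    push_cast at ht
    have hD := E.delay_pos
    obtain ⟨r, hsr, hr⟩ := E.exists_eq (show α s ≤ α s + n * (3 * D + 2) by
      have : (0 : ℝ) ≤ n * (3 * D + 2) := by positivity
      linarith)
    have hMn : 0 < (983 / 1000 : ℝ) ^ n * M := by positivity
    have := E.abs_le_or_decay (s := r) (t := t) S ht₀ (hs.trans hsr) (hTs.trans hsr) hMn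
      (fun p h1 _ => ih p (hsr.trans h1) (hr.symm.trans_le (E.mono h1)))
    rw [pow_succ]
    rcases this with h | h
    · linarith
    · linarith [h.2 (by linarith)]

/-- Grönwall's estimate in clock time, valid from `t₀` on although the delay conditions hold only
after `T`. At the first time `r` where the bound fails, comparison for both signs `c = ±1` shows
that it still holds. -/
theorem abs_lt_exp (E : EqClock a h α A D T) {y φ : ℝ → ℝ} {t₀ x₀ B : ℝ}
    (S : IsSolution a h t₀ φ x₀ y) (ht₀ : 0 ≤ t₀) (hx : |x₀| < B)
    (hφ : ∀ p, p < t₀ → |φ p| ≤ B) :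
    ∀ t, t₀ ≤ t → |y t| < B * Real.exp (α t - α t₀) := by
  intro t ht
  by_contra! hge
  have hexp : Continuous fun p => B * Real.exp (α p - α t₀) := by
    have := E.cont
    fun_prop
  have hB : 0 < B := (abs_nonneg _).trans_lt hx
  have hc : ContinuousOn (fun p => |y p| - B * Real.exp (α p - α t₀)) (Icc t₀ t) :=
    (S.continuousOn le_rfl ht).abs.sub hexp.continuousOn
  have hcpt : IsCompact (Icc t₀ t ∩ (fun p => |y p| - B * Real.exp (α p - α t₀)) ⁻¹' Ici 0) :=
    isCompact_Icc.of_isClosed_subset (hc.preimage_isClosed_of_isClosed isClosed_Icc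
      isClosed_Ici) inter_subset_left
  obtain ⟨r, ⟨⟨h0r, hrt⟩, hr0⟩, hmin⟩ :=
    hcpt.exists_isLeast ⟨t, ⟨ht, le_rfl⟩, sub_nonneg.2 hge⟩
  have hbefore : ∀ p, t₀ ≤ p → p < r → |y p| < B * Real.exp (α p - α t₀) := fun p h1 h2 => by
    by_contra! hn
    exact absurd (hmin ⟨⟨h1, h2.le.trans hrt⟩, sub_nonneg.2 hn⟩) (not_le.2 h2)
  have hone : ∀ p, t₀ ≤ p → 1 ≤ Real.exp (α p - α t₀) := fun p hp =>
    Real.one_le_exp (by linarith [E.mono hp])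
  have key : ∀ c : ℝ, |c| = 1 → c * y r < B * Real.exp (α r - α t₀) := by
    intro c hc1
    have hΦ : ContDiff ℝ 1 fun z => B * Real.exp (z - α t₀) := by fun_prop
    have := (((S.ac le_rfl h0r).const_mul c).sub
      ((E.clock_ac t₀ r).comp_contDiff hΦ)).le_of_ae_deriv_nonpos h0r (by
        filter_upwards [S.ae_eqn, E.clock_deriv, E.coeff_nonneg] with p e1 e2 e3 hp
        have hp0 : 0 ≤ p := by linarith [hp.1]
        refine ⟨_, ?_, ((e1 hp.1.le).const_mul c).sub
          (((e2 hp0).sub_const (α t₀)).exp.const_mul B)⟩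
        have h1 : ∑ k, a k p * (-c * y (h k p)) ≤
            ∑ k, a k p * (B * Real.exp (α p - α t₀)) := by
          refine Finset.sum_le_sum fun k _ => mul_le_mul_of_nonneg_left ?_ (e3 hp0 k)
          have h2 : -c * y (h k p) ≤ |y (h k p)| := by
            refine (le_abs_self _).trans_eq ?_
            rw [abs_mul, abs_neg, hc1, one_mul]
          have h4 := E.le k p hp0
          rcases lt_or_ge (h k p) t₀ with h3 | h3
          · have := hφ _ h3
            rw [S.eq_before _ h3] at h2
            rw [S.eq_before _ h3]
            nlinarith [hone p hp.1.le]
          · have := hbefore _ h3 (h4.trans_lt hp.2)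
            have h5 : Real.exp (α (h k p) - α t₀) ≤ Real.exp (α p - α t₀) :=
              Real.exp_le_exp.2 (by linarith [E.mono h4])
            nlinarith
        rw [← Finset.sum_mul, E.sum_eq p hp0] at h1
        have h6 : ∑ k, a k p * (-c * y (h k p)) = c * -∑ k, a k p * y (h k p) := by
          rw [← Finset.sum_neg_distrib, Finset.mul_sum]
          exact Finset.sum_congr rfl fun k _ => by ring
        rw [h6] at h1
        linarith)
    simp only [Pi.sub_apply, sub_self, Real.exp_zero, mul_one, S.eq_start] at this
    have h7 : c * x₀ ≤ |x₀| := by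
      refine (le_abs_self _).trans_eq ?_
      rw [abs_mul, hc1, one_mul]
    linarith
  have h8 := key 1 (by simp)
  have h9 := key (-1) (by simp)
  have : |y r| < B * Real.exp (α r - α t₀) := abs_lt.2 ⟨by linarith, by linarith⟩
  simp only [mem_preimage, mem_Ici] at hr0
  linarith

/-- Uniform exponential decay with respect to the clock. -/
theorem exists_exp_bound (E : EqClock a h α A D T) : ∃ C μ : ℝ, 0 < C ∧ 0 < μ ∧
    ∀ t₀ : ℝ, 0 ≤ t₀ → ∀ (φ : ℝ → ℝ) (x₀ : ℝ) (y : ℝ → ℝ), IsInitialFunction t₀ φ →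
      IsSolution a h t₀ φ x₀ y → ∀ t, t₀ ≤ t →
        |y t| ≤ C * Real.exp (-μ * (α t - α t₀)) * (|x₀| + initialSup t₀ φ) := by
  have hD := E.delay_pos
  set Λ := 3 * D + 2 with hΛ
  have hΛ0 : 0 < Λ := by linarith
  have hlog : 0 < -Real.log (983 / 1000) := by
    rw [neg_pos]
    exact Real.log_neg (by norm_num) (by norm_num)
  set μ := -Real.log (983 / 1000) / Λ with hμ
  have hμ0 : 0 < μ := by positivity
  -- The clock advances by at most `α T` from `t₀` to `max t₀ T`, so `C₁` bounds the growth through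
  -- the initial window uniformly in `t₀`.
  set C₁ := Real.exp (α T + 2 * D + 1) with hC₁
  have hTn := E.clock_nonneg T
  refine ⟨C₁ * Real.exp (μ * (α T + Λ)), μ, by positivity, hμ0, ?_⟩
  intro t₀ ht₀ φ x₀ y hφ S t ht
  have hαt₀ := E.clock_nonneg t₀
  have hsup : ∀ p, p < t₀ → |φ p| ≤ initialSup t₀ φ := fun p hp => by
    obtain ⟨B, hB⟩ := hφ.2
    exact le_csSup ⟨B, by rintro _ ⟨q, hq, rfl⟩; exact hB q hq⟩ ⟨p, hp, rfl⟩
  have hsup0 : 0 ≤ initialSup t₀ φ := (abs_nonneg _).trans (hsup (t₀ - 1) (by linarith))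
  set s := max t₀ T with hs
  have hαs : α s - α t₀ ≤ α T := by
    rcases le_total t₀ T with h1 | h1
    · rw [hs, max_eq_right h1]
      linarith
    · rw [hs, max_eq_left h1]
      linarith
  have main : ∀ B, |x₀| + initialSup t₀ φ < B →
      |y t| ≤ C₁ * Real.exp (μ * (α T + Λ)) * Real.exp (-μ * (α t - α t₀)) * B := by
    intro B hB
    have hB0 : 0 < B := by linarith [abs_nonneg x₀]
    have hgrow := E.abs_lt_exp S ht₀ (show |x₀| < B by linarith)
      (fun p hp => by linarith [hsup p hp, abs_nonneg x₀])
    have hM : 0 < C₁ * B := by positivity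
    have hearly : ∀ p, t₀ ≤ p → α p ≤ α s + 2 * D + 1 → |y p| ≤ C₁ * B := fun p h1 h2 => by
      refine (hgrow p h1).le.trans ?_
      rw [mul_comm]
      exact mul_le_mul_of_nonneg_right (Real.exp_le_exp.2 (by linarith)) hB0.le
    have hexp : C₁ * Real.exp (μ * (α T + Λ)) * Real.exp (-μ * (α t - α t₀)) * B =
        Real.exp (μ * (α T + Λ - (α t - α t₀))) * (C₁ * B) := by
      rw [show μ * (α T + Λ - (α t - α t₀)) = μ * (α T + Λ) + -μ * (α t - α t₀) by ring,
        Real.exp_add]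
      ring
    rw [hexp]
    rcases le_total t s with hts | hst
    · refine (hearly t ht (by linarith [E.mono hts])).trans ?_
      refine le_mul_of_one_le_left hM.le (Real.one_le_exp (mul_nonneg hμ0.le ?_))
      linarith [E.mono hts]
    · have hall := E.abs_le_of_abs_le S ht₀ (le_max_left t₀ T) (le_max_right t₀ T) hM
        (fun p h1 h2 => hearly p ((le_max_left _ _).trans h1) h2)
      have hαst := E.mono hst
      have hx0 : 0 ≤ (α t - α s) / Λ := div_nonneg (by linarith) hΛ0.le
      have hfl := Nat.floor_le hx0
      have hfl' := Nat.lt_floor_add_one ((α t - α s) / Λ)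
      set n := ⌊(α t - α s) / Λ⌋₊ with hn
      rw [le_div_iff₀ hΛ0] at hfl
      rw [div_lt_iff₀ hΛ0] at hfl'
      refine (E.abs_le_pow S ht₀ (le_max_left t₀ T) (le_max_right t₀ T) hM hall n t hst
        (by linarith)).trans ?_
      gcongr
      have h1 : (983 / 1000 : ℝ) ^ n = Real.exp (-(μ * Λ) * n) := by
        rw [hμ, div_mul_cancel₀ _ hΛ0.ne', neg_neg, mul_comm, Real.exp_nat_mul,
          Real.exp_log (by norm_num)]
      rw [h1]
      apply Real.exp_le_exp.2
      rw [show -(μ * Λ) * (n : ℝ) = μ * (-(n * Λ)) by ring]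
      apply mul_le_mul_of_nonneg_left _ hμ0.le
      linarith
  -- `B` decreases to `|x₀| + initialSup t₀ φ`; the strict inequality was needed for the Grönwall
  -- estimate and covers zero data.
  exact ge_of_tendsto (((continuous_const.mul continuous_id).tendsto _).mono_left
    (nhdsWithin_le_nhds (s := Ioi (|x₀| + initialSup t₀ φ)))) (eventually_mem_nhdsWithin.mono main)

end EqClock

/-! ### Existence of the fundamental function. -/

theorem MeasureTheory.LocallyIntegrable.intervalIntegrable_real {f : ℝ → ℝ}
    (hf : LocallyIntegrable f volume) (p q : ℝ) : IntervalIntegrable f volume p q :=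
  (hf.integrableOn_isCompact isCompact_uIcc).intervalIntegrable

theorem AbsolutelyContinuousOnInterval.congr {f g : ℝ → ℝ} {p q : ℝ}
    (hf : AbsolutelyContinuousOnInterval f p q) (hfg : EqOn f g (uIcc p q)) :
    AbsolutelyContinuousOnInterval g p q := by
  rw [absolutelyContinuousOnInterval_iff] at hf ⊢
  intro ε hε
  obtain ⟨δ, hδ, h⟩ := hf ε hε
  refine ⟨δ, hδ, fun E hE hlen => (Finset.sum_congr rfl fun i hi => ?_).trans_lt (h E hE hlen)⟩
  have := hE.1 i hi
  rw [hfg this.1, hfg this.2]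

namespace DelayParams

variable {m : ℕ} {a h : Fin m → ℝ → ℝ}

theorem exists_coeff_bound (hp : DelayParams a h) :
    ∃ L : ℝ, 0 < L ∧ ∀ᵐ t, 0 ≤ t → ∑ k, |a k t| ≤ L := by
  have : ∀ k, ∃ C : ℝ, ∀ᵐ t, 0 ≤ t → |a k t| ≤ C := fun k => by
    have h1 := (hp.coeff_bounded k).eLpNorm_lt_top
    rw [eLpNorm_exponent_top] at h1
    refine ⟨(eLpNormEssSup (a k) (volume.restrict (Ici 0))).toReal, ?_⟩
    have h2 := ae_le_eLpNormEssSup (f := a k) (μ := volume.restrict (Ici 0))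
    rw [ae_restrict_iff' measurableSet_Ici] at h2
    filter_upwards [h2] with t ht h0
    have := ENNReal.toReal_mono h1.ne (ht h0)
    rwa [toReal_enorm] at this
  choose C hC using this
  refine ⟨∑ k, |C k| + 1, by positivity, ?_⟩
  filter_upwards [ae_all_iff.2 hC] with t ht h0
  have : ∑ k, |a k t| ≤ ∑ k, |C k| :=
    Finset.sum_le_sum fun k _ => (ht k h0).trans (le_abs_self _)
  linarith

end DelayParams

/-- The delayed term `∑ k, a k u * w (h k u)`, set to zero before `t₀`. -/
noncomputable def delayedTerm {m : ℕ} (a h : Fin m → ℝ → ℝ) (t₀ : ℝ) (w : ℝ → ℝ) : ℝ → ℝ :=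
  (Ici t₀).indicator fun u => ∑ k, a k u * w (h k u)

section delayedTerm

variable {m : ℕ} {a h : Fin m → ℝ → ℝ} {t₀ L : ℝ}

theorem delayedTerm_sub (w w' : ℝ → ℝ) (u : ℝ) :
    delayedTerm a h t₀ (fun p => w p - w' p) u =
      delayedTerm a h t₀ w u - delayedTerm a h t₀ w' u := by
  unfold delayedTerm
  by_cases hu : u ∈ Ici t₀
  · simp only [indicator_of_mem hu, ← Finset.sum_sub_distrib, mul_sub]
  · simp only [indicator_of_notMem hu, sub_zero]

theorem delayedTerm_ae_le (hp : DelayParams a h) (ht₀ : 0 ≤ t₀)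
    (hL : ∀ᵐ t, 0 ≤ t → ∑ k, |a k t| ≤ L) (hL0 : 0 < L) {w : ℝ → ℝ} {N : ℝ}
    (hN : ∀ p u, p ≤ u → t₀ ≤ u → |w p| ≤ N * Real.exp (2 * L * (u - t₀))) (hN0 : 0 ≤ N) :
    ∀ᵐ u, ‖delayedTerm a h t₀ w u‖ ≤ L * (N * Real.exp (2 * L * (u - t₀))) := by
  filter_upwards [hL] with u hu
  unfold delayedTerm
  by_cases hu0 : u ∈ Ici t₀
  · have h0 : 0 ≤ u := ht₀.trans hu0
    rw [indicator_of_mem hu0, Real.norm_eq_abs]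
    refine (Finset.abs_sum_le_sum_abs _ _).trans ?_
    refine le_trans ?_ (mul_le_mul_of_nonneg_right (hu h0) (by positivity))
    rw [Finset.sum_mul]
    refine Finset.sum_le_sum fun k _ => ?_
    rw [abs_mul]
    exact mul_le_mul_of_nonneg_left (hN _ _ (hp.delay_le k u h0) hu0) (abs_nonneg _)
  · rw [indicator_of_notMem hu0, norm_zero]
    positivity

theorem delayedTerm_locallyIntegrable (hp : DelayParams a h) (ht₀ : 0 ≤ t₀)
    (hL : ∀ᵐ t, 0 ≤ t → ∑ k, |a k t| ≤ L) (hL0 : 0 < L) {w : ℝ → ℝ} (hw : Measurable w) {N : ℝ}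
    (hN : ∀ p u, p ≤ u → t₀ ≤ u → |w p| ≤ N * Real.exp (2 * L * (u - t₀))) (hN0 : 0 ≤ N) :
    LocallyIntegrable (delayedTerm a h t₀ w) volume := by
  have hc : Continuous fun u => L * (N * Real.exp (2 * L * (u - t₀))) := by fun_prop
  refine (hc.locallyIntegrable (μ := volume)).mono ?_ ?_
  · refine (aestronglyMeasurable_indicator_iff measurableSet_Ici).2 ?_
    have hsub : volume.restrict (Ici t₀) ≤ volume.restrict (Ici (0 : ℝ)) :=
      Measure.restrict_mono (Ici_subset_Ici.2 ht₀) le_rfl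
    refine Finset.aestronglyMeasurable_fun_sum _ fun k _ => ?_
    exact ((hp.coeff_bounded k).1.mono_measure hsub).mul
      ((hw.comp_aemeasurable ((hp.delay_measurable k).mono_measure hsub)).aestronglyMeasurable)
  · filter_upwards [delayedTerm_ae_le hp ht₀ hL hL0 hN hN0] with u hu
    exact hu.trans (le_abs_self _)

/-- The weight exponent `2 * L` is twice the coefficient bound, so integration gains the factor
`1/2` that makes the integral operator a contraction. -/
theorem abs_integral_delayedTerm_le (hp : DelayParams a h) (ht₀ : 0 ≤ t₀)
    (hL : ∀ᵐ t, 0 ≤ t → ∑ k, |a k t| ≤ L) (hL0 : 0 < L) {w : ℝ → ℝ} {N : ℝ}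
    (hN : ∀ p u, p ≤ u → t₀ ≤ u → |w p| ≤ N * Real.exp (2 * L * (u - t₀))) (hN0 : 0 ≤ N)
    {t : ℝ} (ht : t₀ ≤ t) :
    |∫ u in t₀..t, delayedTerm a h t₀ w u| ≤ N / 2 * Real.exp (2 * L * (t - t₀)) := by
  have hc : Continuous fun u => L * (N * Real.exp (2 * L * (u - t₀))) := by fun_prop
  have h1 := intervalIntegral.norm_integral_le_of_norm_le ht
    ((delayedTerm_ae_le hp ht₀ hL hL0 hN hN0).mono fun u hu _ => hu) (hc.intervalIntegrable t₀ t)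
  have h2 : ∫ u in t₀..t, L * (N * Real.exp (2 * L * (u - t₀))) =
      N / 2 * Real.exp (2 * L * (t - t₀)) - N / 2 * Real.exp (2 * L * (t₀ - t₀)) := by
    refine intervalIntegral.integral_eq_sub_of_hasDerivAt
      (f := fun u => N / 2 * Real.exp (2 * L * (u - t₀))) (fun u _ => ?_)
      (hc.intervalIntegrable t₀ t)
    have := ((((hasDerivAt_id u).sub_const t₀).const_mul (2 * L)).exp).const_mul (N / 2)
    convert! this using 1
    simp
    ring
  rw [h2, Real.norm_eq_abs] at h1
  have : 0 ≤ N / 2 * Real.exp (2 * L * (t₀ - t₀)) := by positivity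
  linarith

/-- A bounded function, rescaled by an exponential weight after `t₀` and set to zero before. -/
noncomputable def weighted (t₀ L : ℝ) (z : ℝ → ℝ) : ℝ → ℝ :=
  (Ici t₀).indicator fun p => Real.exp (2 * L * (p - t₀)) * z p

theorem weighted_bound (hL0 : 0 < L) {z : ℝ → ℝ} {N : ℝ} (hz : ∀ p, |z p| ≤ N) :
    ∀ p u, p ≤ u → t₀ ≤ u → |weighted t₀ L z p| ≤ N * Real.exp (2 * L * (u - t₀)) := by
  intro p u hpu _
  have hN0 : 0 ≤ N := (abs_nonneg _).trans (hz p)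
  unfold weighted
  by_cases hpt : p ∈ Ici t₀
  · rw [indicator_of_mem hpt, abs_mul, Real.abs_exp, mul_comm]
    have : Real.exp (2 * L * (p - t₀)) ≤ Real.exp (2 * L * (u - t₀)) := by
      gcongr
    exact mul_le_mul (hz p) this (Real.exp_pos _).le hN0
  · rw [indicator_of_notMem hpt, abs_zero]
    positivity

theorem weighted_measurable {z : ℝ → ℝ} (hz : Measurable z) : Measurable (weighted t₀ L z) :=
  Measurable.indicator (by fun_prop) measurableSet_Ici

/-- Banach's fixed point theorem in an exponentially weighted sup norm gives a global solution of
the integral equation at once. The unknown is the solution divided by its weight, so it is bounded.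
-/
theorem exists_weighted_fixedPoint (hp : DelayParams a h) (ht₀ : 0 ≤ t₀)
    (hL : ∀ᵐ t, 0 ≤ t → ∑ k, |a k t| ≤ L) (hL0 : 0 < L) :
    ∃ z : BoundedContinuousFunction ℝ ℝ, ∀ t, t₀ ≤ t → Real.exp (2 * L * (t - t₀)) * z t =
      1 - ∫ u in t₀..t, delayedTerm a h t₀ (weighted t₀ L z) u := by
  have hloc : ∀ z : BoundedContinuousFunction ℝ ℝ,
      LocallyIntegrable (delayedTerm a h t₀ (weighted t₀ L z)) volume := fun z =>
    delayedTerm_locallyIntegrable hp ht₀ hL hL0 (weighted_measurable z.continuous.measurable)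
      (weighted_bound hL0 z.norm_coe_le_norm) (norm_nonneg z)
  -- The upper limit `max t t₀` extends the operator continuously to all of `ℝ`; only `t ≥ t₀`
  -- matters.
  set J : BoundedContinuousFunction ℝ ℝ → ℝ → ℝ := fun z t =>
    ∫ u in t₀..max t t₀, delayedTerm a h t₀ (weighted t₀ L z) u with hJ
  have hJc : ∀ z, Continuous (J z) := fun z =>
    (intervalIntegral.continuous_primitive (hloc z).intervalIntegrable_real t₀).comp
      (continuous_id.max continuous_const)
  have hJle : ∀ z t, |J z t| ≤ ‖z‖ / 2 * Real.exp (2 * L * (max t t₀ - t₀)) := fun z t =>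
    abs_integral_delayedTerm_le hp ht₀ hL hL0 (weighted_bound hL0 z.norm_coe_le_norm)
      (norm_nonneg z) (le_max_right t t₀)
  have hJsub : ∀ z z' t, J z t - J z' t = J (z - z') t := fun z z' t => by
    simp only [hJ]
    rw [← intervalIntegral.integral_sub ((hloc z).intervalIntegrable_real _ _)
      ((hloc z').intervalIntegrable_real _ _)]
    congr 1
    funext u
    rw [← delayedTerm_sub]
    congr 1
    funext p
    unfold weighted
    by_cases hpt : p ∈ Ici t₀
    · simp only [indicator_of_mem hpt, BoundedContinuousFunction.coe_sub, Pi.sub_apply]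
      ring
    · simp only [indicator_of_notMem hpt, sub_zero]
  set e : ℝ → ℝ := fun t => Real.exp (-(2 * L * (max t t₀ - t₀))) with he
  have hec : Continuous e := by fun_prop
  have hee : ∀ t, e t * Real.exp (2 * L * (max t t₀ - t₀)) = 1 := fun t => by
    simp only [he]
    rw [← Real.exp_add, neg_add_cancel, Real.exp_zero]
  have he1 : ∀ t, e t ≤ 1 := fun t => Real.exp_le_one_iff.2 (by
    have : 0 ≤ max t t₀ - t₀ := sub_nonneg.2 (le_max_right _ _)
    rw [neg_nonpos]
    positivity)
  have he0 : ∀ t, 0 < e t := fun t => Real.exp_pos _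
  have heJ : ∀ z t, |e t * J z t| ≤ ‖z‖ / 2 := fun z t => by
    rw [abs_mul, abs_of_pos (he0 t)]
    calc e t * |J z t| ≤ e t * (‖z‖ / 2 * Real.exp (2 * L * (max t t₀ - t₀))) :=
          mul_le_mul_of_nonneg_left (hJle z t) (he0 t).le
      _ = ‖z‖ / 2 * (e t * Real.exp (2 * L * (max t t₀ - t₀))) := by ring
      _ = ‖z‖ / 2 := by rw [hee, mul_one]
  set F : BoundedContinuousFunction ℝ ℝ → BoundedContinuousFunction ℝ ℝ := fun z =>
    BoundedContinuousFunction.ofNormedAddCommGroup (fun t => e t * (1 - J z t))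
      (hec.mul (continuous_const.sub (hJc z))) (1 + ‖z‖ / 2) (fun t => by
        rw [mul_sub, mul_one]
        refine (norm_sub_le _ _).trans (add_le_add ?_ (heJ z t))
        rw [Real.norm_eq_abs, abs_of_pos (he0 t)]
        exact he1 t) with hF
  have hFc : ContractingWith (1 / 2) F := by
    refine ⟨by norm_num, LipschitzWith.of_dist_le_mul fun z z' => ?_⟩
    have h2 : ((1 / 2 : NNReal) : ℝ) * dist z z' = ‖z' - z‖ / 2 := by
      rw [dist_comm, dist_eq_norm]
      push_cast
      ring
    rw [h2, BoundedContinuousFunction.dist_le (by positivity)]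
    intro t
    have h3 : F z t - F z' t = e t * J (z' - z) t := by
      rw [← hJsub]
      simp only [hF, BoundedContinuousFunction.coe_ofNormedAddCommGroup]
      ring
    rw [Real.dist_eq, h3]
    exact heJ _ t
  refine ⟨ContractingWith.fixedPoint F hFc, fun t ht => ?_⟩
  have hfix := DFunLike.congr_fun hFc.fixedPoint_isFixedPt t
  set z := ContractingWith.fixedPoint F hFc
  have hFz : F z t = e t * (1 - J z t) := rfl
  rw [← hfix, hFz, hJ]
  have hm : max t t₀ = t := max_eq_left ht
  have := hee t
  simp only [hm] at this ⊢
  linear_combination (1 - ∫ u in t₀..t, delayedTerm a h t₀ (weighted t₀ L z) u) * this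

end delayedTerm

namespace DelayParams

variable {m : ℕ} {a h : Fin m → ℝ → ℝ}

theorem exists_solution (hp : DelayParams a h) {t₀ : ℝ} (ht₀ : 0 ≤ t₀) :
    ∃ x, IsSolution a h t₀ (fun _ => 0) 1 x := by
  obtain ⟨L, hL0, hL⟩ := hp.exists_coeff_bound
  obtain ⟨z, hz⟩ := exists_weighted_fixedPoint hp ht₀ hL hL0
  set x := weighted t₀ L z with hx
  have hloc : LocallyIntegrable (delayedTerm a h t₀ x) volume :=
    delayedTerm_locallyIntegrable hp ht₀ hL hL0 (weighted_measurable z.continuous.measurable)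
      (weighted_bound hL0 z.norm_coe_le_norm) (norm_nonneg z)
  have hxt : ∀ t, t₀ ≤ t → x t = 1 - ∫ u in t₀..t, delayedTerm a h t₀ x u := fun t ht => by
    rw [← hz t ht, hx, weighted, indicator_of_mem (show t ∈ Ici t₀ from ht)]
  refine ⟨x, ⟨fun T hT => ?_, ?_, fun t ht => ?_, ?_⟩⟩
  · have h1 := (hloc.intervalIntegrable_real t₀ T).absolutelyContinuousOnInterval_intervalIntegral
      (c := t₀) left_mem_uIcc
    have h2 : AbsolutelyContinuousOnInterval (fun _ : ℝ => (1 : ℝ)) t₀ T :=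
      (LipschitzWith.const (1 : ℝ)).lipschitzOnWith.absolutelyContinuousOnInterval
    refine (h2.sub h1).congr fun t ht => ?_
    rw [uIcc_of_le hT] at ht
    exact (hxt t ht.1).symm
  · rw [ae_restrict_iff' measurableSet_Ici]
    filter_upwards [LocallyIntegrable.ae_hasDerivAt_integral hloc, Measure.ae_ne volume t₀] with t ht hne htm
    have hlt : t₀ < t := lt_of_le_of_ne htm hne.symm
    have h1 := (ht t₀).const_sub 1
    have h2 : delayedTerm a h t₀ x t = ∑ k, a k t * x (h k t) := indicator_of_mem htm _
    rw [h2] at h1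
    refine h1.congr_of_eventuallyEq ?_
    filter_upwards [Ioi_mem_nhds hlt] with u hu
    exact hxt u (le_of_lt hu)
  · rw [hx, weighted, indicator_of_notMem (by simpa using ht)]
  · rw [hxt t₀ le_rfl, intervalIntegral.integral_same, sub_zero]

end DelayParams

/-! ### The coefficient clock and its growth. -/

theorem exists_ae_of_eventually_essAtTop {p : ℝ → Prop} (hp : ∀ᶠ t in essAtTop, p t) :
    ∃ T : ℝ, 0 ≤ T ∧ ∀ᵐ t, T ≤ t → p t := by
  obtain ⟨s, hs, r, hr, hsr⟩ := eventually_inf.1 hp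
  obtain ⟨T, hT⟩ := mem_atTop_sets.1 hs
  refine ⟨max T 0, le_max_right _ _, ?_⟩
  filter_upwards [hr] with t ht hTt
  exact hsr t ⟨hT t ((le_max_left _ _).trans hTt), ht⟩

/-- The clock `t ↦ ∫ s in 0..t, ∑ k, a k s`, constant before `0`. -/
noncomputable def coeffClock {m : ℕ} (a : Fin m → ℝ → ℝ) (t : ℝ) : ℝ :=
  ∫ s in (0 : ℝ)..t, (Ioi (0 : ℝ)).indicator (fun u => ∑ k, a k u) s

namespace DelayParams

variable {m : ℕ} {a h : Fin m → ℝ → ℝ}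

theorem locallyIntegrable_rate (hp : DelayParams a h) :
    LocallyIntegrable ((Ioi (0 : ℝ)).indicator (fun u => ∑ k, a k u)) volume := by
  have h1 : MemLp (fun u => ∑ k, a k u) ⊤ (volume.restrict (Ici (0 : ℝ))) :=
    memLp_finsetSum _ fun k _ => hp.coeff_bounded k
  exact ((memLp_indicator_iff_restrict measurableSet_Ioi).2
    (h1.mono_measure (Measure.restrict_mono Ioi_subset_Ici_self le_rfl))).locallyIntegrable le_top

theorem coeffClock_sub (hp : DelayParams a h) (p q : ℝ) : coeffClock a q - coeffClock a p =
    ∫ s in p..q, (Ioi (0 : ℝ)).indicator (fun u => ∑ k, a k u) s :=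
  intervalIntegral.integral_interval_sub_left (hp.locallyIntegrable_rate.intervalIntegrable_real _ _)
    (hp.locallyIntegrable_rate.intervalIntegrable_real _ _)

theorem integral_eq_coeffClock_sub (hp : DelayParams a h) {p q : ℝ} (h0 : 0 ≤ p) (hq : 0 ≤ q) :
    ∫ s in p..q, ∑ k, a k s = coeffClock a q - coeffClock a p := by
  rw [hp.coeffClock_sub]
  refine intervalIntegral.integral_congr_ae (Eventually.of_forall fun s hs => ?_)
  rw [indicator_of_mem]
  exact (le_min h0 hq).trans_lt hs.1

end DelayParams

theorem ae_forall_coeff_nonneg {m : ℕ} {a : Fin m → ℝ → ℝ}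
    (ha : ∀ k, ∀ᵐ t ∂(volume.restrict (Ici (0 : ℝ))), 0 ≤ a k t) :
    ∀ᵐ t, 0 ≤ t → ∀ k, 0 ≤ a k t := by
  have := ae_all_iff.2 ha
  rwa [ae_restrict_iff' measurableSet_Ici] at this

theorem ae_rate_nonneg {m : ℕ} {a : Fin m → ℝ → ℝ}
    (ha : ∀ k, ∀ᵐ t ∂(volume.restrict (Ici (0 : ℝ))), 0 ≤ a k t) :
    ∀ᵐ t, 0 ≤ (Ioi (0 : ℝ)).indicator (fun u => ∑ k, a k u) t := by
  filter_upwards [ae_forall_coeff_nonneg ha] with t ht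
  exact indicator_apply_nonneg fun h0 => Finset.sum_nonneg fun k _ => ht (le_of_lt h0) k

theorem coeffClock_of_nonpos {m : ℕ} (a : Fin m → ℝ → ℝ) {p : ℝ} (hp : p ≤ 0) :
    coeffClock a p = 0 := by
  unfold coeffClock
  rw [intervalIntegral.integral_congr (g := fun _ => (0 : ℝ)), intervalIntegral.integral_zero]
  intro s hs
  rw [uIcc_of_ge hp] at hs
  exact indicator_of_notMem (not_lt.2 hs.2) _

namespace DelayParams

variable {m : ℕ} {a h : Fin m → ℝ → ℝ}

/-- The clock vanishes on negative times, so truncating the delayed argument at `0` does not change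
its clock value. -/
theorem delayIntegral_eq (hp : DelayParams a h) (k : Fin m) {t : ℝ} (ht : 0 ≤ t) :
    delayIntegral a h k t = coeffClock a t - coeffClock a (h k t) := by
  unfold delayIntegral
  rw [hp.integral_eq_coeffClock_sub (le_max_right _ _) ht]
  rcases le_total (h k t) 0 with h1 | h1
  · rw [max_eq_right h1, coeffClock_of_nonpos a h1, coeffClock_of_nonpos a le_rfl]
  · rw [max_eq_left h1]

theorem coeffClock_mono (hp : DelayParams a h)
    (ha : ∀ k, ∀ᵐ t ∂(volume.restrict (Ici (0 : ℝ))), 0 ≤ a k t) :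
    Monotone (coeffClock a) := fun p q hpq => by
  rw [← sub_nonneg, hp.coeffClock_sub]
  exact intervalIntegral.integral_nonneg_of_ae hpq (ae_rate_nonneg ha)

theorem coeffClock_tendsto (hp : DelayParams a h)
    (ha : ∀ k, ∀ᵐ t ∂(volume.restrict (Ici (0 : ℝ))), 0 ≤ a k t)
    (hdiv : ∫⁻ t in Ici (0 : ℝ), ENNReal.ofReal (∑ k, a k t) = ⊤) :
    Tendsto (coeffClock a) atTop atTop := by
  refine tendsto_atTop_atTop_of_monotone (hp.coeffClock_mono ha) fun b => ?_
  -- A bounded clock would make the nonnegative rate integrable on the half-line, against the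
  -- divergence.
  by_contra! hb
  set f := (Ioi (0 : ℝ)).indicator (fun u => ∑ k, a k u) with hf
  have hint : IntegrableOn f (Ioi 0) := by
    refine integrableOn_Ioi_of_intervalIntegral_norm_bounded (l := atTop) (b := fun t => t) b 0
      (fun t => ?_) tendsto_id (Eventually.of_forall fun t => ?_)
    · exact (hp.locallyIntegrable_rate.integrableOn_isCompact isCompact_Icc).mono_set
        Ioc_subset_Icc_self
    · refine le_trans (le_of_eq ?_) (hb t).le
      refine intervalIntegral.integral_congr_ae ?_
      filter_upwards [ae_rate_nonneg ha] with s hs _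
      exact Real.norm_of_nonneg hs
  have h1 := hint.lintegral_lt_top
  rw [setLIntegral_congr Ioi_ae_eq_Ici.symm] at hdiv
  have h2 : ∫⁻ t in Ioi (0 : ℝ), ENNReal.ofReal (f t) =
      ∫⁻ t in Ioi (0 : ℝ), ENNReal.ofReal (∑ k, a k t) :=
    setLIntegral_congr_fun measurableSet_Ioi fun t ht => by
      simp only [hf, indicator_of_mem ht]
  rw [h2, hdiv] at h1
  exact lt_irrefl _ h1

theorem exists_eqClock (hp : DelayParams a h)
    (ha : ∀ k, ∀ᵐ t ∂(volume.restrict (Ici (0 : ℝ))), 0 ≤ a k t)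
    (hne : ∀ᵐ t ∂(volume.restrict (Ici (0 : ℝ))), ∑ k, a k t ≠ 0)
    (hdelay : limsup (fun t : ℝ =>
        ((∑ k, a k t / (∑ i, a i t) * delayIntegral a h k t : ℝ) : EReal)) essAtTop
      < ((1 + 1 / Real.exp 1 : ℝ) : EReal))
    (hdiv : ∫⁻ t in Ici (0 : ℝ), ENNReal.ofReal (∑ k, a k t) = ⊤)
    (hbdd : ∀ k, limsup (fun t : ℝ => (delayIntegral a h k t : EReal)) essAtTop < ⊤) :
    ∃ D T, EqClock a h (coeffClock a) (fun t => ∑ k, a k t) D T := by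
  obtain ⟨T₁, hT₁0, hT₁⟩ := exists_ae_of_eventually_essAtTop (eventually_lt_of_limsup_lt hdelay)
  have : ∀ k, ∃ D T : ℝ, ∀ᵐ t, T ≤ t → delayIntegral a h k t < D := fun k => by
    obtain ⟨D, hD, -⟩ := EReal.lt_iff_exists_real_btwn.1 (hbdd k)
    obtain ⟨T, -, hT⟩ := exists_ae_of_eventually_essAtTop (eventually_lt_of_limsup_lt hD)
    refine ⟨D, T, ?_⟩
    filter_upwards [hT] with t ht h1
    exact EReal.coe_lt_coe_iff.1 (ht h1)
  choose D T hT using this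
  have hDle : ∀ k, D k ≤ ∑ k, |D k| + 1 := fun k => by
    have := Finset.single_le_sum (f := fun k => |D k|) (fun k _ => abs_nonneg _)
      (Finset.mem_univ k)
    linarith [le_abs_self (D k)]
  have hTle : ∀ k, T k ≤ T₁ + ∑ k, |T k| := fun k => by
    have := Finset.single_le_sum (f := fun k => |T k|) (fun k _ => abs_nonneg _)
      (Finset.mem_univ k)
    linarith [le_abs_self (T k)]
  have hsum : 0 ≤ ∑ k, |T k| := by positivity
  have hloc := hp.locallyIntegrable_rate
  refine ⟨∑ k, |D k| + 1, T₁ + ∑ k, |T k|, ?_⟩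
  exact
    { mono := hp.coeffClock_mono ha
      cont := intervalIntegral.continuous_primitive hloc.intervalIntegrable_real 0
      clock_ac := fun p q => by
        have h1 := (hloc.intervalIntegrable_real (min (min p q) 0) (max (max p q) 0)
          ).absolutelyContinuousOnInterval_intervalIntegral (c := 0)
          (mem_uIcc_of_le (min_le_right _ _) (le_max_right _ _))
        refine h1.mono ?_
        rw [uIcc_of_le ((min_le_right _ (0 : ℝ)).trans (le_max_right _ _))]
        exact Icc_subset_Icc (min_le_left _ _) (le_max_left _ _)
      tendsto := hp.coeffClock_tendsto ha hdiv
      clock_nonneg := fun t => by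
        rw [← coeffClock_of_nonpos a (min_le_right t 0)]
        exact hp.coeffClock_mono ha (min_le_left _ _)
      delay_pos := by positivity
      start_nonneg := by positivity
      clock_deriv := by
        filter_upwards [LocallyIntegrable.ae_hasDerivAt_integral hloc, Measure.ae_ne volume 0]
          with t ht hne h0
        have h1 := ht 0
        rwa [indicator_of_mem (show t ∈ Ioi (0 : ℝ) from lt_of_le_of_ne h0 hne.symm)] at h1
      coeff_nonneg := ae_forall_coeff_nonneg ha
      sum_eq := fun _ _ => rfl
      le := hp.delay_le
      mean := by
        filter_upwards [hT₁, ae_forall_coeff_nonneg ha, (ae_restrict_iff' measurableSet_Ici).1 hne]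
          with t e1 e2 e3 ht
        have h0 : 0 ≤ t := by linarith
        have h1 := EReal.coe_lt_coe_iff.1 (e1 (by linarith))
        have hA : 0 < ∑ k, a k t :=
          lt_of_le_of_ne (Finset.sum_nonneg fun k _ => e2 h0 k) (e3 h0).symm
        -- The only use of the number `e`: the rest of the argument works with the mean delay bound
        -- `1 + 46/125 = 171/125`.
        have he : 1 / Real.exp 1 ≤ 46 / 125 := by
          rw [div_le_iff₀ (Real.exp_pos 1)]
          linarith [Real.exp_one_gt_d9]
        have h2 : ∑ k, a k t * (coeffClock a t - coeffClock a (h k t)) =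
            (∑ k, a k t / (∑ i, a i t) * delayIntegral a h k t) * ∑ k, a k t := by
          rw [Finset.sum_mul]
          refine Finset.sum_congr rfl fun k _ => ?_
          rw [hp.delayIntegral_eq k h0]
          field_simp
        rw [h2]
        exact mul_le_mul_of_nonneg_right (by linarith) hA.le
      delay := by
        filter_upwards [ae_all_iff.2 hT] with t ht h1 k
        rw [← hp.delayIntegral_eq k (by linarith)]
        exact (ht k ((hTle k).trans h1)).trans_le (hDle k) }

/-- After some `T` each step of length `R` advances the clock by at least a fixed amount; the
constant `K` absorbs the time before `T` and the incomplete last step. -/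
theorem exists_linear_growth (hp : DelayParams a h)
    (ha : ∀ k, ∀ᵐ t ∂(volume.restrict (Ici (0 : ℝ))), 0 ≤ a k t)
    {R : ℝ} (hR : 0 < R)
    (hinf : 0 < liminf (fun t : ℝ => ((∫ τ in t..(t + R), ∑ k, a k τ : ℝ) : EReal)) atTop) :
    ∃ κ K : ℝ, 0 < κ ∧ ∀ s t, 0 ≤ s → s ≤ t →
      κ * (t - s) - K ≤ coeffClock a t - coeffClock a s := by
  obtain ⟨κ, hκ0, hκ⟩ := EReal.lt_iff_exists_real_btwn.1 hinf
  have hκ0 : 0 < κ := EReal.coe_lt_coe_iff.1 hκ0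
  obtain ⟨T, hT⟩ := eventually_atTop.1
    ((eventually_lt_of_lt_liminf hκ).and (eventually_ge_atTop (0 : ℝ)))
  have hT0 : 0 ≤ T := (hT T le_rfl).2
  have hmono := hp.coeffClock_mono ha
  have hstep : ∀ s, T ≤ s → coeffClock a s + κ ≤ coeffClock a (s + R) := fun s hs => by
    have h1 := EReal.coe_lt_coe_iff.1 (hT s hs).1
    rw [hp.integral_eq_coeffClock_sub (by linarith) (by linarith)] at h1
    linarith
  have hsteps : ∀ (n : ℕ) s, T ≤ s → coeffClock a s + n * κ ≤ coeffClock a (s + n * R) := by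
    intro n s hs
    induction n with
    | zero => simp
    | succ n ih =>
      have h2 := hstep (s + n * R) (by have : (0 : ℝ) ≤ n * R := by positivity
                                       linarith)
      push_cast
      rw [show s + (n + 1) * R = s + n * R + R by ring]
      linarith
  have hlate : ∀ s t, T ≤ s → s ≤ t →
      κ * ((t - s) / R - 1) ≤ coeffClock a t - coeffClock a s := by
    intro s t hs hst
    have h0 : 0 ≤ (t - s) / R := div_nonneg (by linarith) hR.le
    have h1 := Nat.floor_le h0
    have h2 := Nat.lt_floor_add_one ((t - s) / R)
    have h3 := hsteps ⌊(t - s) / R⌋₊ s hs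
    rw [le_div_iff₀ hR] at h1
    have h4 := hmono (show s + ⌊(t - s) / R⌋₊ * R ≤ t by linarith)
    nlinarith
  refine ⟨κ / R, κ * (T / R + 1), by positivity, fun s t hs hst => ?_⟩
  have hrw : κ / R * (t - s) - κ * (T / R + 1) = κ * ((t - (s + T)) / R - 1) := by
    field_simp
    ring
  rw [hrw]
  rcases le_total (s + T) t with h1 | h1
  · linarith [hlate (s + T) t (by linarith) h1, hmono (show s ≤ s + T by linarith)]
  · have h2 : (t - (s + T)) / R ≤ 0 := div_nonpos_of_nonpos_of_nonneg (by linarith) hR.le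
    nlinarith [hmono hst]

end DelayParams

/-! ### Conclusion. -/

theorem theorem1 {m : ℕ} (a h : Fin m → ℝ → ℝ) (hp : DelayParams a h)
    (ha : ∀ k, ∀ᵐ t ∂(volume.restrict (Ici (0 : ℝ))), 0 ≤ a k t)
    (hne : ∀ᵐ t ∂(volume.restrict (Ici (0 : ℝ))), ∑ k, a k t ≠ 0)
    (hdelay : limsup (fun t : ℝ =>
        ((∑ k, a k t / (∑ i, a i t) * delayIntegral a h k t : ℝ) : EReal)) essAtTop
      < ((1 + 1 / Real.exp 1 : ℝ) : EReal))
    (hdiv : ∫⁻ t in Ici (0 : ℝ), ENNReal.ofReal (∑ k, a k t) = ⊤)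
    (hbdd : ∀ k, limsup (fun t : ℝ => (delayIntegral a h k t : EReal)) essAtTop < ⊤) :
    IsAsymptoticallyStableEq a h ∧
    ((∃ R : ℝ, 0 < R ∧
        0 < liminf (fun t : ℝ => ((∫ τ in t..(t + R), ∑ k, a k τ : ℝ) : EReal)) atTop) →
      FundamentalFunctionHasExpEstimate a h ∧
      ((∀ k, limsup (fun t : ℝ => ((t - h k t : ℝ) : EReal)) essAtTop < ⊤) →
        IsExponentiallyStableEq a h)) := by
  obtain ⟨D, T, E⟩ := hp.exists_eqClock ha hne hdelay hdiv hbdd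
  obtain ⟨C, μ, hC, hμ, hbound⟩ := E.exists_exp_bound
  refine ⟨⟨fun t₀ ht₀ ε hε => ⟨ε / C, by positivity, fun φ x₀ x hφ S hδ t ht => ?_⟩,
    fun t₀ ht₀ φ x₀ x hφ S => ?_⟩, fun ⟨R, hR, hinf⟩ => ?_⟩
  · have hB : 0 ≤ |x₀| + initialSup t₀ φ :=
      add_nonneg (abs_nonneg _) (Real.sSup_nonneg (by rintro _ ⟨q, -, rfl⟩; exact abs_nonneg _))
    have h1 := hbound t₀ ht₀ φ x₀ x hφ S t ht
    have h2 : Real.exp (-μ * (coeffClock a t - coeffClock a t₀)) ≤ 1 :=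
      Real.exp_le_one_iff.2 (by nlinarith [E.mono ht])
    rw [lt_div_iff₀ hC] at hδ
    have h3 : C * Real.exp (-μ * (coeffClock a t - coeffClock a t₀)) *
        (|x₀| + initialSup t₀ φ) ≤ C * 1 * (|x₀| + initialSup t₀ φ) := by gcongr
    linarith
  · refine squeeze_zero_norm' (a := fun t => C * Real.exp (-μ * (coeffClock a t - coeffClock a t₀))
      * (|x₀| + initialSup t₀ φ)) ?_ ?_
    · filter_upwards [eventually_ge_atTop t₀] with t ht
      exact hbound t₀ ht₀ φ x₀ x hφ S t ht
    · have h1 : Tendsto (fun t => -μ * (coeffClock a t - coeffClock a t₀)) atTop atBot :=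
        (tendsto_atTop_add_const_right _ (-coeffClock a t₀) E.tendsto).const_mul_atTop_of_neg
          (neg_lt_zero.2 hμ)
      have h2 := ((Real.tendsto_exp_atBot.comp h1).const_mul C).mul_const
        (|x₀| + initialSup t₀ φ)
      simpa using h2
  · obtain ⟨κ, K, hκ, hgrow⟩ := hp.exists_linear_growth ha hR hinf
    -- Linear growth of the clock turns decay in the clock into decay in `t`; the estimate of the
    -- fundamental function is the case of zero initial function and initial value `1`.
    have hexp : IsExponentiallyStableEq a h := by
      refine ⟨C * Real.exp (μ * K), μ * κ, by positivity, by positivity,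
        fun t₀ ht₀ φ x₀ x hφ S t ht => (hbound t₀ ht₀ φ x₀ x hφ S t ht).trans ?_⟩
      have hB : 0 ≤ |x₀| + initialSup t₀ φ :=
        add_nonneg (abs_nonneg _) (Real.sSup_nonneg (by rintro _ ⟨q, -, rfl⟩; exact abs_nonneg _))
      rw [mul_assoc C (Real.exp (μ * K)), ← Real.exp_add]
      gcongr
      nlinarith [hgrow t₀ t ht₀ ht]
    refine ⟨⟨?_, ?_⟩, fun _ => hexp⟩
    · choose X hX using fun (s : ℝ) (hs : 0 ≤ s) => hp.exists_solution hs
      classical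
      refine ⟨fun t s => if hs : 0 ≤ s then X s hs t else 0, fun s hs => ?_⟩
      simpa only [hs, dite_true] using hX s hs
    · obtain ⟨M, lam, hM, hlam, hest⟩ := hexp
      refine ⟨M, lam, hM, hlam, fun X hX t s hs hst => ?_⟩
      have h1 := hest s hs (fun _ => 0) 1 (fun t => X t s)
        ⟨measurable_const, 0, fun t _ => by simp⟩ (hX s hs) t hst
      have h2 : initialSup s (fun _ => 0) = 0 := by
        unfold initialSup
        simp only [abs_zero]
        rw [Set.Nonempty.image_const nonempty_Iio, csSup_singleton]
      simpa [h2] using h1
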